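/- Let $n\ge 1$, $\hbar>0$, $\tau>0$. On $\mathbb R^{2m}=\mathbb R^m\times\mathbb R^m$ put $\omega(x,y;x',y')=x\cdot y'-x'\cdot y$, and define the left pulled action and the Schrödinger representation of the Heisenberg group by $$[\Lambda_\hbar(x,y)f](x',y')=e^{\pi i\hbar(x\cdot y'-y\cdot x')}f(x'-x,y'-y),\qquad [\rho_\hbar(x,y)f](t)=e^{\pi i\hbar(-2y\cdot t+x\cdot y)}f(t-x),$$ and the symplectic Fourier transform by $\widehat a(x,y)=(\hbar/2)^m\int_{\mathbb R^{2m}} a(x',y')\,e^{\pi i\hbar(x'\cdot y-y'\cdot x)}\,dx'\,dy'$. The Weyl pseudodifferential operator (PDO) on $L^2(\mathbb R^m)$ with symbol $a$ is $a(D,X)=\int_{\mathbb R^{2m}}\widehat a(x,y)\,\rho_\hbar(x,y)\,dx\,dy$, understood weakly on Schwartz functions (with $\widehat a$ a tempered distribution). Let $\varphi_\tau(t)=2^{n/4}e^{-\pi\hbar|t|^2/\tau}$ and $\Phi_\tau(x,y)=e^{-\frac{\pi\hbar}{2\tau}(|x|^2+\tau^2|y|^2)}$. Let $F_\tau\subset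 L^2(\mathbb R^{2n})$ be the closed subspace of the functions $(x,y)\mapsto\langle f,\rho_\hbar(x,y)\varphi_\tau\rangle$, $f\in L^2(\mathbb R^n)$, and $P_\tau$ the orthogonal projection onto it. For $\psi\in L^\infty(\mathbb R^{2n})$ let $T_\psi:L^2(\mathbb R^{2n})\to F_\tau$, $T_\psi f=P_\tau(\psi f)$, be the Toeplitz operator. **Theorem.** (1) There is a unitary operator $U$ on $L^2(\mathbb R^{2n})$ such that for every $\psi\in L^\infty(\mathbb R^{2n})$ the operator $U\,T_\psi\,U^{-1}$ (with $F_\tau\subset L^2(\mathbb R^{2n})$) is the Weyl PDO on $L^2(\mathbb R^{2n})$ with the symbol $$a^{\#}_\psi(x_1,x_2,y_1,y_2)=\hbar^{3n}\int_{\mathbb R^{2n}}\psi(x,y)\,\bigl[\Lambda_\hbar(2x-x_1,2y-y_1)\Phi_\tau\bigr](\tau y_2,x_2/\tau)\,dx\,dy =\hbar^{3n}\int_{\mathbb R^{2n}}\psi(x,y)\,\overline{\bigl[\Lambda_\hbar(\tau y_2,x_2/\tau)\Phi_\tau\bigr](2x-x_1,2y-y_1)}\,dx\,dy ,$$ the integrals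 being absolutely convergent. (2) The map $\psi\mapsto a^{\#}_\psi$ is invertible on its range: it is injective on $L^\infty(\mathbb R^{2n})$ (even if symbols are only compared almost everywhere), and, defined by the same integral, it maps $L^2(\mathbb R^{2n})$ into $L^2(\mathbb R^{4n})$ with $\|a^{\#}_\psi\|^2=\hbar^{3n}\|\psi\|^2$ and has a bounded linear left inverse $L^2(\mathbb R^{4n})\to L^2(\mathbb R^{2n})$. (3) In contrast, the heat-flow smoothing $\psi\mapsto a_\psi$ that gives Guillemin's symbol, $a_\psi(x,y)=\hbar^{2n}\int_{\mathbb R^{2n}}\psi(x',y')\,\Phi_\tau(x-2x',y-2y')\,dx'\,dy'$, maps $L^2(\mathbb R^{2n})$ to itself but has no bounded linear left inverse on $L^2(\mathbb R^{2n})$. -/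

import Mathlib

open MeasureTheory
open scoped ENNReal ComplexConjugate SchwartzMap

noncomputable section

/-- The configuration space `ℝ^ι` with its Euclidean structure and Lebesgue measure. -/
abbrev Config (ι : Type) : Type := EuclideanSpace ℝ ι

/-- The phase space: pairs `(x, y)` with `x, y ∈ ℝ^ι`. -/
abbrev Phase (ι : Type) : Type := Config ι × Config ι

/-- The complex Hilbert space `L²(X)` for the canonical (Lebesgue) measure of `X`. -/
abbrev L2 (X : Type) [MeasureSpace X] : Type := Lp ℂ 2 (volume : Measure X)

variable {ι : Type} [Fintype ι]

/-- The symplectic form `ω(x, y; x', y') = x·y' - x'·y`. -/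
def symplForm (p q : Phase ι) : ℝ := inner ℝ p.1 q.2 - inner ℝ q.1 p.2

/-- The left pulled action
`[Λ_ħ(0,x,y) f](x', y') = exp(πiħ(x·y' - y·x')) f(x' - x, y' - y)` of the Heisenberg group. -/
def leftAction (h : ℝ) (p : Phase ι) (f : Phase ι → ℂ) : Phase ι → ℂ :=
  fun q => Complex.exp (Real.pi * Complex.I * h * symplForm p q) * f (q - p)

/-- The Schrödinger representation
`[ρ_ħ(0,x,y) f](t) = exp(πiħ(-2 y·t + x·y)) f(t - x)` of the Heisenberg group. -/
def schrodinger (h : ℝ) (p : Phase ι) (f : Config ι → ℂ) : Config ι → ℂ :=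
  fun t => Complex.exp (Real.pi * Complex.I * h *
    ((-2 * inner ℝ p.2 t + inner ℝ p.1 p.2 : ℝ) : ℂ)) * f (t - p.1)

/-- The covariant transform (Fourier--Wigner transform)
`W(f, φ)(x, y) = ⟨f, ρ_ħ(0,x,y) φ⟩ = ∫ f(t) conj([ρ_ħ(0,x,y) φ](t)) dt`. -/
def fourierWigner (h : ℝ) (f φ : Config ι → ℂ) : Phase ι → ℂ :=
  fun p => ∫ t, f t * conj (schrodinger h p φ t)

/-- The symplectic Fourier transform
`(ħ/2)^m ∫ a(x', y') exp(πiħ(x'·y - y'·x)) dx' dy'`, where `m` is the dimension of `ℝ^ι`. -/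
def symplFourier (h : ℝ) (a : Phase ι → ℂ) : Phase ι → ℂ :=
  fun p => ((h / 2) ^ Fintype.card ι : ℝ) *
    ∫ q, a q * Complex.exp (Real.pi * Complex.I * h * symplForm q p)

/-- The matrix coefficient `(x, y) ↦ ⟨ρ_ħ(0,x,y) f, g⟩` of the Schrödinger representation. -/
def matrixCoeff (h : ℝ) (f g : Config ι → ℂ) : Phase ι → ℂ :=
  fun p => ∫ t, schrodinger h p f t * conj (g t)

/-- `A` is the Weyl pseudodifferential operator `a(D, X)` with the symbol `a`, that is the
integrated Schrödinger representation `ρ_ħ(â) = ∫ â(x, y) ρ_ħ(0,x,y) dx dy` of the symplectic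
Fourier transform `â` of `a`, the integral being understood in the weak sense: for Schwartz
functions `f`, `g` with the matrix coefficient `V(p) = ⟨ρ_ħ(p) f, g⟩`,
`⟨A f, g⟩ = ∫ â(p) V(p) dp = ∫ a(p) V̂(-p) dp`.
The last form also defines the pairing of `â` and `V` if `â` is only a tempered distribution;
for integrable `a` and `V` the two integrals agree by `integral_symplFourier_mul` below. -/
def IsWeylPDO (h : ℝ) (a : Phase ι → ℂ) (A : L2 (Config ι) →L[ℂ] L2 (Config ι)) : Prop :=
  ∀ f g : 𝓢(Config ι, ℂ),
    Integrable (fun p : Phase ι => a p * symplFourier h (matrixCoeff h f g) (-p)) ∧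
    inner ℂ (g.toLp 2 volume : L2 (Config ι)) (A (f.toLp 2 volume)) =
      ∫ p : Phase ι, a p * symplFourier h (matrixCoeff h f g) (-p)

theorem symplForm_swap_neg (p q : Phase ι) : symplForm q (-p) = symplForm p q := by
  simp only [symplForm, Prod.fst_neg, Prod.snd_neg, inner_neg_left, inner_neg_right]
  rw [real_inner_comm p.2 q.1, real_inner_comm q.2 p.1]
  rw [real_inner_comm q.1 p.2, real_inner_comm p.1 q.2]
  ring

theorem continuous_symplForm :
    Continuous (fun z : Phase ι × Phase ι => symplForm z.1 z.2) := by
  unfold symplForm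
  fun_prop

/-- The two forms of the weak integral in `IsWeylPDO` agree when both make sense. -/
theorem integral_symplFourier_mul (h : ℝ) (a V : Phase ι → ℂ)
    (ha : Integrable a) (hV : Integrable V) :
    ∫ p, symplFourier h a p * V p = ∫ p, a p * symplFourier h V (-p) := by
  have hint : Integrable (Function.uncurry fun p q : Phase ι =>
      a q * Complex.exp (Real.pi * Complex.I * h * symplForm q p) * V p)
      (volume.prod volume) := by
    have h1 : Integrable (fun z : Phase ι × Phase ι => V z.1 * a z.2)
        (volume.prod volume) := hV.mul_prod ha
    have h2 : Continuous (fun z : Phase ι × Phase ι =>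
        Complex.exp (Real.pi * Complex.I * h * symplForm z.2 z.1)) := by
      have := (continuous_symplForm (ι := ι)).comp continuous_swap
      exact Complex.continuous_exp.comp
        (continuous_const.mul (Complex.continuous_ofReal.comp this))
    have h3 := h1.bdd_mul (c := 1) h2.aestronglyMeasurable (by
      refine Filter.Eventually.of_forall fun z => ?_
      have : (Real.pi * Complex.I * h * symplForm z.2 z.1 : ℂ)
          = ((Real.pi * h * symplForm z.2 z.1 : ℝ) : ℂ) * Complex.I := by
        push_cast; ring
      rw [this, Complex.norm_exp_ofReal_mul_I])
    refine h3.congr (Filter.Eventually.of_forall fun z => ?_)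
    simp only [Function.uncurry]
    ring
  calc ∫ p, symplFourier h a p * V p
      = ((h / 2) ^ Fintype.card ι : ℝ) * ∫ p, ∫ q,
          a q * Complex.exp (Real.pi * Complex.I * h * symplForm q p) * V p := by
        rw [← integral_const_mul]
        refine integral_congr_ae (Filter.Eventually.of_forall fun p => ?_)
        simp only [symplFourier]
        rw [integral_mul_const, mul_assoc]
    _ = ((h / 2) ^ Fintype.card ι : ℝ) * ∫ q, ∫ p,
          a q * Complex.exp (Real.pi * Complex.I * h * symplForm q p) * V p := by
        rw [integral_integral_swap hint]
    _ = ∫ p, a p * symplFourier h V (-p) := by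
        rw [← integral_const_mul]
        refine integral_congr_ae (Filter.Eventually.of_forall fun q => ?_)
        simp only [symplFourier, symplForm_swap_neg]
        rw [← integral_const_mul, ← integral_const_mul, ← integral_const_mul]
        refine integral_congr_ae (Filter.Eventually.of_forall fun p => ?_)
        simp only
        ring

/-- The squeezed Gaussian `φ_τ(t) = 2^{m/4} exp(-πħ|t|²/τ)` on `ℝ^ι`, `m` the dimension. -/
def groundState (h τ : ℝ) : Config ι → ℂ :=
  fun t => (((2 : ℝ) ^ ((Fintype.card ι : ℝ) / 4) * Real.exp (-Real.pi * h * ‖t‖ ^ 2 / τ) : ℝ) : ℂ)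

/-- The Gaussian `Φ_τ(x, y) = exp(-(πħ/(2τ)) (|x|² + τ²|y|²))` on the phase space. -/
def phaseGaussian (h τ : ℝ) : Phase ι → ℂ :=
  fun p => (Real.exp (-(Real.pi * h / (2 * τ)) * (‖p.1‖ ^ 2 + τ ^ 2 * ‖p.2‖ ^ 2)) : ℂ)

variable (ι) in
/-- The (pre-)Fock--Segal--Bargmann space `F_τ ⊆ L²(ℝ^ι × ℝ^ι)`: the closed subspace formed by
the covariant transforms `W(f, φ_τ)`, `f ∈ L²(ℝ^ι)`. -/
def fsbSpace (h τ : ℝ) : Submodule ℂ (L2 (Phase ι)) :=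
  (Submodule.span ℂ {F : L2 (Phase ι) |
    ∃ f : L2 (Config ι), F =ᵐ[volume] fourierWigner h f (groundState h τ)}).topologicalClosure

instance (h τ : ℝ) : CompleteSpace (fsbSpace ι h τ) :=
  inferInstanceAs (CompleteSpace (Submodule.topologicalClosure _))

/-- The operator of multiplication by `ψ ∈ L^∞` on `L²`. -/
def mulOp (ψ : Lp ℂ ∞ (volume : Measure (Phase ι))) : L2 (Phase ι) →L[ℂ] L2 (Phase ι) :=
  (ContinuousLinearMap.mul ℂ ℂ).holderL volume ∞ 2 2 ψ

/-- The Toeplitz operator `T_ψ : L²(ℝ^ι × ℝ^ι) → F_τ`, `T_ψ f = P_τ(ψ f)`, where `P_τ` is the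
orthogonal projection onto `F_τ`. -/
def toeplitz (h τ : ℝ) (ψ : Lp ℂ ∞ (volume : Measure (Phase ι))) :
    L2 (Phase ι) →L[ℂ] fsbSpace ι h τ :=
  (fsbSpace ι h τ).orthogonalProjectionOnto ∘L mulOp ψ

/-- The configuration space `ℝ^{2n}`, the points of which are `(t₁, t₂)` with `t₁, t₂ ∈ ℝ^n`. -/
abbrev DoubleConfig (n : ℕ) : Type := Config (Fin n ⊕ Fin n)

/-- The two halves of a vector of `ℝ^{2n}`. -/
def halves {n : ℕ} (v : DoubleConfig n) : Config (Fin n) × Config (Fin n) :=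
  EuclideanSpace.sumEquivProd v

/-- The point `(x₁, y₁)` for `p = (x₁, x₂, y₁, y₂)`. -/
def firstPair {n : ℕ} (p : Phase (Fin n ⊕ Fin n)) : Phase (Fin n) :=
  ((halves p.1).1, (halves p.2).1)

/-- The point `(τ y₂, x₂ / τ)` for `p = (x₁, x₂, y₁, y₂)`. -/
def secondPair {n : ℕ} (τ : ℝ) (p : Phase (Fin n ⊕ Fin n)) : Phase (Fin n) :=
  (τ • (halves p.2).2, τ⁻¹ • (halves p.1).2)

/-- The symbol, a function of `p = (x₁, x₂, y₁, y₂)`: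
`ħ^{3n} ∫ ψ(x, y) [Λ_ħ(0, 2x - x₁, 2y - y₁) Φ_τ](τ y₂, x₂/τ) dx dy`. -/
def toeplitzSymbol {n : ℕ} (h τ : ℝ) (ψ : Phase (Fin n) → ℂ) : Phase (Fin n ⊕ Fin n) → ℂ :=
  fun p => ((h ^ (3 * n) : ℝ) : ℂ) *
    ∫ z, ψ z * leftAction h ((2 : ℝ) • z - firstPair p) (phaseGaussian h τ) (secondPair τ p)

/-- Guillemin's symbol, obtained from `ψ` by the heat flow (convolution with a Gaussian):
`ħ^{2n} ∫ ψ(x', y') Φ_τ(x - 2x', y - 2y') dx' dy'`. -/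
def guilleminSymbol {n : ℕ} (h τ : ℝ) (ψ : Phase (Fin n) → ℂ) : Phase (Fin n) → ℂ :=
  fun p => ((h ^ (2 * n) : ℝ) : ℂ) * ∫ z, ψ z * phaseGaussian h τ (p - (2 : ℝ) • z)

end

/-! (1) Let `B` map `L²(ℝ^{2n})` onto `L²` of the phase space: multiply by the chirp `exp(-2πiħ
t₁·t₂/τ)`, take the Fourier transform, rescale, and adjust the phase
(`exists_unitary_eq_chirpTransform`). Because the Fourier transform of a Gaussian is a Gaussian, `B
(f ⊗ φ_τ)` is a multiple of the covariant transform of `f` (`chirpTransform_tensor`). So `B` carries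
`L² ⊗ φ_τ` onto `F_τ`, and `P_τ B g` is again an explicit integral, `groundTransform`
(`orthogonalProjection_unitary_ae_eq`).

With `U = B⁻¹` this gives `⟨U T_ψ U⁻¹ f, g⟩ = ∫ ψ(z) (B f)(z) conj((P_τ B g)(z)) dz`, a
superposition of rank-one forms with weight `ψ`. It remains to see that the kernel of the symbol
integral at `z`, as a function of `p`, is the Weyl symbol of the form at `z`. The symplectic Fourier
transform of a matrix coefficient is, at `-p`, the matrix coefficient with the first function
reflected (`symplFourier_matrixCoeff_neg`). Hence the claim reduces to one Gaussian integral
(`integral_leftAction_pair`), whose value is a function of `s` times a function of `t`. Since `s +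
t` is the first half of `p`, what is left is the integral of a convolution, which is a product of
two integrals (`integral_symbol_kernel_mul_matrixCoeff`). Fubini is allowed because matrix
coefficients of Schwartz functions are integrable (`integrable_matrixCoeff`).

(2) In the coordinates `r = (τ y₂, x₂/τ)` and `c = (x₁, y₁) + r` the symbol is, up to a unimodular
factor, a windowed symplectic Fourier transform of `ψ` with Gaussian window. Plancherel in `r`
followed by integration in `c` multiplies the squared norm by a constant
(`lintegral_enorm_toeplitzSymbol_sq`). The identity holds in `[0, ∞]`, so it also gives injectivity
on `L^∞`.

(3) The heat flow preserves `L²` by a Schur estimate. By the Riemann–Lebesgue lemma it sends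
Gaussians modulated with growing frequency to functions tending to zero in `L²`, while the norms of
the Gaussians stay fixed. A bounded left inverse would contradict this. -/

open scoped FourierTransform Topology

/-! ### General facts on the Fourier transform and `L²` -/

open scoped ContDiff in
/-- The `L²` Fourier transform of a function in `L¹ ∩ L²` is given by the Fourier integral. -/
theorem fourier_toLp_ae_eq {V : Type*} [NormedAddCommGroup V] [InnerProductSpace ℝ V]
    [FiniteDimensional ℝ V] [MeasurableSpace V] [BorelSpace V] {f : V → ℂ}
    (h1 : Integrable f) (h2 : MemLp f 2) :
    (Lp.fourierTransformₗᵢ V ℂ (h2.toLp f) : V → ℂ) =ᵐ[volume] 𝓕 f := by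
  have hloc : LocallyIntegrable (Lp.fourierTransformₗᵢ V ℂ (h2.toLp f) : V → ℂ) :=
    (Lp.memLp _).locallyIntegrable (by norm_num)
  have hcont : Continuous (𝓕 f) :=
    VectorFourier.fourierIntegral_continuous Real.continuous_fourierChar
      continuous_inner h1
  -- Test against compactly supported smooth functions: the `L²` transform agrees with the
  -- distributional one, and the Fourier integral moves across the pairing, `∫ ĝ f = ∫ g f̂`.
  refine ae_eq_of_integral_contDiff_smul_eq hloc hcont.locallyIntegrable fun g hg hgs => ?_
  have hg' : ContDiff ℝ ∞ (fun x => (g x : ℂ)) := Complex.ofRealCLM.contDiff.comp hg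
  have hgs' : HasCompactSupport (fun x => (g x : ℂ)) :=
    hgs.comp_left (g := fun r : ℝ => (r : ℂ)) Complex.ofReal_zero
  let G : 𝓢(V, ℂ) := hgs'.toSchwartzMap hg'
  have hG : ∀ x, G x = g x := fun x => rfl
  have e1 := congrArg (fun T => T G) (Lp.fourier_toTemperedDistribution_eq (h2.toLp f))
  simp only [Lp.toTemperedDistribution_apply, TemperedDistribution.fourier_apply] at e1
  have e2 : ∫ x, (𝓕 G) x • (h2.toLp f : V → ℂ) x = ∫ x, (𝓕 G) x • f x :=
    integral_congr_ae (by filter_upwards [h2.coeFn_toLp] with x hx; rw [hx])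
  have e3 : ∫ x, (𝓕 (G : V → ℂ)) x • f x = ∫ x, G x • (𝓕 f) x := by
    simpa using! (VectorFourier.integral_fourierIntegral_smul_eq_flip (L := innerₗ V)
      Real.continuous_fourierChar continuous_inner G.integrable h1)
  have h3 := calc ∫ x, g x • (Lp.fourierTransformₗᵢ V ℂ (h2.toLp f) : V → ℂ) x
    _ = ∫ x, G x • (Lp.fourierTransformₗᵢ V ℂ (h2.toLp f) : V → ℂ) x := by
        simp [hG]
    _ = ∫ x, (𝓕 G) x • f x := by rw [← e2, e1]; rfl
    _ = ∫ x, G x • (𝓕 f) x := by rw [← e3]; rfl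
    _ = ∫ x, g x • (𝓕 f) x := by simp only [hG, smul_eq_mul, Complex.real_smul]
  exact h3

/-- Plancherel's formula for functions in `L¹ ∩ L²`. -/
theorem lintegral_enorm_fourier_sq {V : Type*} [NormedAddCommGroup V] [InnerProductSpace ℝ V]
    [FiniteDimensional ℝ V] [MeasurableSpace V] [BorelSpace V] {f : V → ℂ}
    (h1 : Integrable f) (h2 : MemLp f 2) :
    ∫⁻ w, ‖𝓕 f w‖ₑ ^ 2 = ∫⁻ v, ‖f v‖ₑ ^ 2 := by
  have key : eLpNorm (𝓕 f) 2 volume = eLpNorm f 2 volume := by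
    rw [← eLpNorm_congr_ae (fourier_toLp_ae_eq h1 h2), ← Lp.enorm_def,
      ← ofReal_norm, LinearIsometryEquiv.norm_map, ofReal_norm, Lp.enorm_def,
      eLpNorm_congr_ae h2.coeFn_toLp]
  simp only [eLpNorm_eq_lintegral_rpow_enorm_toReal (p := 2) (by norm_num) (by norm_num)] at key
  simpa using ENNReal.rpow_left_injective (by norm_num) key

/-- Weighted composition operators with a weight of constant modulus are unitary, if the modulus
compensates the scaling of the measure. -/
theorem exists_weightedComposition {X Y : Type*} [MeasurableSpace X] [MeasurableSpace Y]
    {μ : Measure X} {ν : Measure Y} (e : X ≃ᵐ Y) {m : X → ℂ} (hm : Measurable m) {c : ℝ}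
    (hc : 0 < c) (hmc : ∀ x, ‖m x‖ = c) (he : μ.map e = ENNReal.ofReal (c⁻¹ ^ 2) • ν) :
    ∃ T : Lp ℂ 2 ν ≃ₗᵢ[ℂ] Lp ℂ 2 μ, ∀ F : Lp ℂ 2 ν, T F =ᵐ[μ] fun x => m x * F (e x) := by
  have hc0 : ENNReal.ofReal (c⁻¹ ^ 2) ≠ 0 := by simp; positivity
  have hqmp : Measure.QuasiMeasurePreserving e μ ν :=
    ⟨e.measurable, by rw [he]; exact Measure.smul_absolutelyContinuous⟩
  have hm0 : ∀ x, m x ≠ 0 := fun x hx => by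
    have := hmc x; rw [hx, norm_zero] at this; exact hc.ne this
  have hnorm : ∀ F : Y → ℂ, AEStronglyMeasurable F ν →
      eLpNorm (fun x => m x * F (e x)) 2 μ = eLpNorm F 2 ν := by
    intro F hF
    have h1 : eLpNorm (fun x => m x * F (e x)) 2 μ = eLpNorm ((c : ℂ) • (F ∘ e)) 2 μ := by
      refine eLpNorm_congr_norm_ae (Filter.Eventually.of_forall fun x => ?_)
      simp [hmc, abs_of_pos hc]
    have h2 : eLpNorm (F ∘ e) 2 μ = eLpNorm F 2 (μ.map e) :=
      (eLpNorm_map_measure (by rw [he]; exact hF.smul_measure _) e.measurable.aemeasurable).symm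
    rw [h1, eLpNorm_const_smul, h2, he, eLpNorm_smul_measure_of_ne_top (by norm_num),
      smul_eq_mul, ← mul_assoc, ENNReal.ofReal_rpow_of_pos (by positivity)]
    -- The modulus `c` of the weight cancels the square root of the factor `c⁻²` by which the
    -- measure is scaled.
    have : ‖(c : ℂ)‖ₑ * ENNReal.ofReal ((c⁻¹ ^ 2) ^ (1 / (2 : ℝ≥0∞)).toReal) = 1 := by
      rw [← ofReal_norm, Complex.norm_real, Real.norm_of_nonneg hc.le,
        ← ENNReal.ofReal_mul hc.le]
      have : ((c⁻¹ ^ 2) ^ (1 / (2 : ℝ≥0∞)).toReal : ℝ) = c⁻¹ := by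
        rw [← Real.rpow_natCast, ← Real.rpow_mul (by positivity)]; simp
      rw [this, mul_inv_cancel₀ hc.ne', ENNReal.ofReal_one]
    rw [this, one_mul]
  have hmem : ∀ F : Lp ℂ 2 ν, MemLp (fun x => m x * F (e x)) 2 μ := fun F =>
    ⟨hm.aestronglyMeasurable.mul
      ((Lp.aestronglyMeasurable F).comp_quasiMeasurePreserving hqmp),
      by rw [hnorm _ (Lp.aestronglyMeasurable F)]; exact Lp.eLpNorm_lt_top F⟩
  let T₀ : Lp ℂ 2 ν →ₗ[ℂ] Lp ℂ 2 μ :=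
    { toFun := fun F => (hmem F).toLp _
      map_add' := fun F G => by
        rw [← MemLp.toLp_add]
        refine MemLp.toLp_congr _ _ ?_
        filter_upwards [hqmp.ae (Lp.coeFn_add F G)] with x hx
        simp only [hx, Pi.add_apply]; ring
      map_smul' := fun r F => by
        rw [RingHom.id_apply, ← MemLp.toLp_const_smul]
        refine MemLp.toLp_congr _ _ ?_
        filter_upwards [hqmp.ae (Lp.coeFn_smul r F)] with x hx
        simp only [hx, Pi.smul_apply, smul_eq_mul]; ring }
  have hT₀ : ∀ F, T₀ F =ᵐ[μ] fun x => m x * F (e x) := fun F => (hmem F).coeFn_toLp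
  let T₁ : Lp ℂ 2 ν →ₗᵢ[ℂ] Lp ℂ 2 μ :=
    ⟨T₀, fun F => by
      rw [Lp.norm_def, Lp.norm_def, eLpNorm_congr_ae (hT₀ F),
        hnorm _ (Lp.aestronglyMeasurable F)]⟩
  have hsurj : Function.Surjective T₁ := by
    intro G
    have hqmp' : Measure.QuasiMeasurePreserving e.symm ν μ := by
      refine ⟨e.symm.measurable, ?_⟩
      have : ν ≪ μ.map e := by
        rw [he]; exact Measure.absolutelyContinuous_smul hc0
      have h3 := this.map e.symm.measurable
      rwa [Measure.map_map e.symm.measurable e.measurable, e.symm_comp_self,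
        Measure.map_id] at h3
    have hms : AEStronglyMeasurable (fun y => (m (e.symm y))⁻¹ * G (e.symm y)) ν :=
      (hm.comp e.symm.measurable).inv.aestronglyMeasurable.mul
        ((Lp.aestronglyMeasurable G).comp_quasiMeasurePreserving hqmp')
    have hmem' : MemLp (fun y => (m (e.symm y))⁻¹ * G (e.symm y)) 2 ν := by
      refine ⟨hms, ?_⟩
      rw [← hnorm _ hms]
      simp only [e.symm_apply_apply, mul_inv_cancel_left₀ (hm0 _)]
      exact Lp.eLpNorm_lt_top G
    refine ⟨hmem'.toLp _, Lp.ext ?_⟩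
    refine (hT₀ _).trans ?_
    filter_upwards [hqmp.ae hmem'.coeFn_toLp] with x hx
    simp only [hx, e.symm_apply_apply, mul_inv_cancel_left₀ (hm0 _)]
  exact ⟨LinearIsometryEquiv.ofSurjective T₁ hsurj, hT₀⟩

/-! ### Coordinates -/

section Coordinates

variable {n : ℕ}

theorem measurePreserving_halves :
    MeasurePreserving (halves : DoubleConfig n → Config (Fin n) × Config (Fin n)) := by
  have h1 := (PiLp.sumPiLpEquivProdLpPiLp 2
    (fun _ : Fin n ⊕ Fin n => ℝ) (𝕜 := ℝ)).measurePreserving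
  have h2 := WithLp.volume_preserving_ofLp (Config (Fin n)) (Config (Fin n))
  exact h2.comp h1

/-- The two halves of a vector as a measurable equivalence. -/
noncomputable def halvesEquiv (n : ℕ) :
    DoubleConfig n ≃ᵐ Config (Fin n) × Config (Fin n) :=
  (EuclideanSpace.sumEquivProd (𝕜 := ℝ) (ι := Fin n) (κ := Fin n)).toHomeomorph.toMeasurableEquiv

theorem inner_eq_halves (v w : DoubleConfig n) :
    inner ℝ v w = inner ℝ (halves v).1 (halves w).1 + inner ℝ (halves v).2 (halves w).2 := by
  simp only [PiLp.inner_apply, Fintype.sum_sum_type]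
  rfl

theorem continuous_halves : Continuous (halves : DoubleConfig n → _) :=
  (EuclideanSpace.sumEquivProd (𝕜 := ℝ) (ι := Fin n) (κ := Fin n)).continuous

end Coordinates

/-! ### Gaussian integrals -/

/-- The Fourier integral of a translated Gaussian. -/
theorem integral_shifted_gaussian_mul_cexp {ι : Type*} [Fintype ι] {α : ℝ} (hα : 0 < α) (β : ℝ)
    (k w : EuclideanSpace ℝ ι) :
    ∫ v : EuclideanSpace ℝ ι, (Real.exp (-α * ‖v - k‖ ^ 2) : ℂ) *
        Complex.exp (Complex.I * β * (inner ℝ w v : ℝ)) =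
      (((Real.pi / α) ^ ((Fintype.card ι : ℝ) / 2) : ℝ) : ℂ) *
        (Real.exp (-(β ^ 2 * ‖w‖ ^ 2 / (4 * α))) : ℂ) *
        Complex.exp (Complex.I * β * (inner ℝ w k : ℝ)) := by
  have hα' : 0 < (α : ℂ).re := hα
  rw [← integral_add_right_eq_self _ k]
  have : ∀ v : EuclideanSpace ℝ ι, (Real.exp (-α * ‖v + k - k‖ ^ 2) : ℂ) *
        Complex.exp (Complex.I * β * (inner ℝ w (v + k) : ℝ)) =
      Complex.exp (-α * ‖v‖ ^ 2 + (Complex.I * β) * (inner ℝ w v : ℝ)) *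
        Complex.exp (Complex.I * β * (inner ℝ w k : ℝ)) := by
    intro v
    rw [add_sub_cancel_right, inner_add_right, Complex.ofReal_exp, ← Complex.exp_add,
      ← Complex.exp_add]
    congr 1
    push_cast
    ring
  simp_rw [this]
  rw [integral_mul_const,
    GaussianFourier.integral_cexp_neg_mul_sq_norm_add_of_euclideanSpace hα']
  congr 2
  · rw [Complex.ofReal_cpow (by positivity)]
    push_cast
    rfl
  · rw [Complex.ofReal_exp]
    congr 1
    push_cast
    rw [mul_pow, Complex.I_sq]
    ring

theorem integrable_shifted_gaussian {ι : Type*} [Fintype ι] {α : ℝ} (hα : 0 < α)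
    (k : EuclideanSpace ℝ ι) :
    Integrable (fun v : EuclideanSpace ℝ ι => Real.exp (-α * ‖v - k‖ ^ 2)) := by
  have h := GaussianFourier.integrable_cexp_neg_mul_sq_norm_add (V := EuclideanSpace ℝ ι)
    (b := (α : ℂ)) (by simpa using hα) 0 0
  have h' := (h.norm.comp_sub_right k)
  refine h'.congr (Filter.Eventually.of_forall fun v => ?_)
  simp only [zero_mul, add_zero, Complex.norm_exp]
  norm_cast

theorem integral_shifted_gaussian {ι : Type*} [Fintype ι] {α : ℝ} (hα : 0 < α)
    (k : EuclideanSpace ℝ ι) :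
    ∫ v : EuclideanSpace ℝ ι, Real.exp (-α * ‖v - k‖ ^ 2) =
      (Real.pi / α) ^ ((Fintype.card ι : ℝ) / 2) := by
  have h := integral_shifted_gaussian_mul_cexp hα 0 k 0
  simp only [Complex.ofReal_zero, mul_zero, zero_mul, Complex.exp_zero, mul_one, norm_zero,
    ne_eq, OfNat.ofNat_ne_zero, not_false_eq_true, zero_pow, zero_div, neg_zero, Real.exp_zero,
    Complex.ofReal_one] at h
  rw [integral_complex_ofReal] at h
  exact_mod_cast h

instance phase_volume_isAddHaarMeasure {ι : Type} [Fintype ι] :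
    (volume : Measure (Phase ι)).IsAddHaarMeasure :=
  inferInstanceAs
    (((volume : Measure (Config ι)).prod (volume : Measure (Config ι))).IsAddHaarMeasure)

/-! ### The phase space Gaussian -/

section PhaseGaussian

variable {ι : Type} [Fintype ι]

theorem phaseGaussian_eq_mul (h τ : ℝ) (p : Phase ι) :
    phaseGaussian h τ p = ((Real.exp (-(Real.pi * h / (2 * τ)) * ‖p.1‖ ^ 2) *
      Real.exp (-(Real.pi * h * τ / 2) * ‖p.2‖ ^ 2) : ℝ) : ℂ) := by
  rw [phaseGaussian, ← Real.exp_add]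
  congr 2
  rcases eq_or_ne τ 0 with rfl | hτ
  · simp
  · field_simp
    ring

theorem phaseGaussian_neg (h τ : ℝ) (p : Phase ι) :
    phaseGaussian h τ (-p) = phaseGaussian h τ p := by
  simp [phaseGaussian]

theorem phaseGaussian_sub_comm (h τ : ℝ) (p q : Phase ι) :
    phaseGaussian h τ (p - q) = phaseGaussian h τ (q - p) := by
  rw [← neg_sub, phaseGaussian_neg]

theorem continuous_phaseGaussian (h τ : ℝ) :
    Continuous (phaseGaussian h τ : Phase ι → ℂ) := by
  unfold phaseGaussian
  fun_prop

theorem phaseGaussian_ne_zero (h τ : ℝ) (p : Phase ι) : phaseGaussian h τ p ≠ 0 := by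
  simp [phaseGaussian]

/-- Squaring doubles `ħ`, so every `L²` computation with the Gaussian reduces to an `L¹`
computation. -/
theorem norm_phaseGaussian_sq (h τ : ℝ) (p : Phase ι) :
    ‖phaseGaussian h τ p‖ ^ 2 = ‖phaseGaussian (2 * h) τ p‖ := by
  simp only [phaseGaussian, Complex.norm_real, Real.norm_eq_abs, Real.abs_exp]
  rw [← Real.exp_nat_mul]
  congr 1
  push_cast
  ring

theorem norm_phaseGaussian_le_one {h τ : ℝ} (hh : 0 < h) (hτ : 0 < τ) (p : Phase ι) :
    ‖phaseGaussian h τ p‖ ≤ 1 := by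
  simp only [phaseGaussian, Complex.norm_real, Real.norm_eq_abs, Real.abs_exp]
  rw [Real.exp_le_one_iff, neg_mul, neg_nonpos]
  positivity

theorem integrable_phaseGaussian {h τ : ℝ} (hh : 0 < h) (hτ : 0 < τ) : Integrable (phaseGaussian h τ : Phase ι → ℂ) := by
  have h1 := integrable_shifted_gaussian (ι := ι) (α := Real.pi * h / (2 * τ)) (by positivity) 0
  have h2 := integrable_shifted_gaussian (ι := ι) (α := Real.pi * h * τ / 2) (by positivity) 0
  simp only [sub_zero] at h1 h2
  refine (h1.mul_prod h2).ofReal.congr (Filter.Eventually.of_forall fun p => ?_)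
  rw [phaseGaussian_eq_mul]
  rfl

/-- The two factors contribute `(2τ/ħ)^{m/2}` and `(2/(ħτ))^{m/2}`, so the squeezing cancels. -/
theorem integral_norm_phaseGaussian {h τ : ℝ} (hh : 0 < h) (hτ : 0 < τ) :
    ∫ p : Phase ι, ‖phaseGaussian h τ p‖ = (2 / h) ^ Fintype.card ι := by
  have h1 := integral_shifted_gaussian (ι := ι) (α := Real.pi * h / (2 * τ)) (by positivity) 0
  have h2 := integral_shifted_gaussian (ι := ι) (α := Real.pi * h * τ / 2) (by positivity) 0
  simp only [sub_zero] at h1 h2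
  have : ∀ p : Phase ι, ‖phaseGaussian h τ p‖ =
      Real.exp (-(Real.pi * h / (2 * τ)) * ‖p.1‖ ^ 2) *
      Real.exp (-(Real.pi * h * τ / 2) * ‖p.2‖ ^ 2) := fun p => by
    rw [phaseGaussian_eq_mul, Complex.norm_real, Real.norm_of_nonneg (by positivity)]
  simp_rw [this]
  rw [Measure.volume_eq_prod, 
    integral_prod_mul (fun x : Config ι => Real.exp (-(Real.pi * h / (2 * τ)) * ‖x‖ ^ 2))
      (fun y : Config ι => Real.exp (-(Real.pi * h * τ / 2) * ‖y‖ ^ 2)), h1, h2, ← Real.mul_rpow (by positivity) (by positivity)]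
  have : Real.pi / (Real.pi * h / (2 * τ)) * (Real.pi / (Real.pi * h * τ / 2)) = (2 / h) ^ 2 := by
    field_simp
  rw [this, ← Real.rpow_natCast, ← Real.rpow_natCast, ← Real.rpow_mul (by positivity)]
  congr 1
  push_cast
  ring

theorem memLp_phaseGaussian_shift_one {h τ : ℝ} (hh : 0 < h) (hτ : 0 < τ)
    (c : Phase ι) :
    MemLp (fun z : Phase ι => phaseGaussian h τ (c - (2 : ℝ) • z)) 1 := by
  rw [memLp_one_iff_integrable]
  simp_rw [phaseGaussian_sub_comm h τ c]
  exact ((integrable_phaseGaussian hh hτ).comp_sub_right c).comp_smul two_ne_zero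

theorem memLp_phaseGaussian_shift_two {h τ : ℝ} (hh : 0 < h) (hτ : 0 < τ)
    (c : Phase ι) :
    MemLp (fun z : Phase ι => phaseGaussian h τ (c - (2 : ℝ) • z)) 2 := by
  have hc : Continuous (fun z : Phase ι => phaseGaussian h τ (c - (2 : ℝ) • z)) :=
    (continuous_phaseGaussian h τ).comp (by fun_prop)
  rw [memLp_two_iff_integrable_sq_norm hc.aestronglyMeasurable]
  simp_rw [norm_phaseGaussian_sq]
  exact (memLp_one_iff_integrable.1 (memLp_phaseGaussian_shift_one (by positivity) hτ c)).norm

theorem memLp_phaseGaussian_shift_top {h τ : ℝ} (hh : 0 < h) (hτ : 0 < τ)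
    (c : Phase ι) :
    MemLp (fun z : Phase ι => phaseGaussian h τ (c - (2 : ℝ) • z)) ∞ := by
  have hc : Continuous (fun z : Phase ι => phaseGaussian h τ (c - (2 : ℝ) • z)) :=
    (continuous_phaseGaussian h τ).comp (by fun_prop)
  exact memLp_top_of_bound hc.aestronglyMeasurable 1
    (Filter.Eventually.of_forall fun z => norm_phaseGaussian_le_one hh hτ _)

/-- Hölder's inequality pairs `L²` with `L²` and `L^∞` with `L¹`. The alternative is kept in the
hypothesis so that the same symbol estimates serve Toeplitz operators (bounded `ψ`) and the isometry
(square integrable `ψ`). -/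
theorem integrable_mul_phaseGaussian_shift {h τ : ℝ} (hh : 0 < h) (hτ : 0 < τ)
    {ψ : Phase ι → ℂ}
    (hψ : MemLp ψ 2 ∨ MemLp ψ ∞) (c : Phase ι) :
    Integrable (fun z => ψ z * phaseGaussian h τ (c - (2 : ℝ) • z)) := by
  rcases hψ with hψ | hψ
  · exact hψ.integrable_mul (memLp_phaseGaussian_shift_two hh hτ c)
  · exact memLp_one_iff_integrable.1
      ((memLp_phaseGaussian_shift_one hh hτ c).mul hψ (p := ∞) (q := 1) (r := 1))

theorem memLp_two_mul_phaseGaussian_shift {h τ : ℝ} (hh : 0 < h) (hτ : 0 < τ)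
    {ψ : Phase ι → ℂ}
    (hψ : MemLp ψ 2 ∨ MemLp ψ ∞) (c : Phase ι) :
    MemLp (fun z => ψ z * phaseGaussian h τ (c - (2 : ℝ) • z)) 2 := by
  rcases hψ with hψ | hψ
  · exact (memLp_phaseGaussian_shift_top hh hτ c).mul hψ (p := 2) (q := ∞) (r := 2)
  · exact (memLp_phaseGaussian_shift_two hh hτ c).mul hψ (p := ∞) (q := 2) (r := 2)

theorem lintegral_enorm_phaseGaussian_sq {h τ : ℝ} (hh : 0 < h) (hτ : 0 < τ)
    (q : Phase ι) :
    ∫⁻ c : Phase ι, ‖phaseGaussian h τ (c - q)‖ₑ ^ 2 = ENNReal.ofReal (h⁻¹ ^ Fintype.card ι) := by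
  rw [lintegral_sub_right_eq_self (fun c : Phase ι => ‖phaseGaussian h τ c‖ₑ ^ 2) q]
  have : ∀ c : Phase ι, ‖phaseGaussian h τ c‖ₑ ^ 2 = ‖phaseGaussian (2 * h) τ c‖ₑ := fun c => by
    rw [← ofReal_norm, ← ofReal_norm, ← norm_phaseGaussian_sq, ENNReal.ofReal_pow (norm_nonneg _)]
  simp_rw [this]
  rw [← ofReal_integral_norm_eq_lintegral_enorm (integrable_phaseGaussian (by positivity) hτ),
    integral_norm_phaseGaussian (by positivity) hτ]
  congr 2
  field_simp

end PhaseGaussian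

/-! ### Linear changes of variables -/

section ChangeOfVariables

variable {n : ℕ}

/-- The linear map `(x, y) ↦ (s y, t x)` of the phase space. -/
noncomputable def scaleSwap (n : ℕ) (s t : ℝ) (hs : s ≠ 0) (ht : t ≠ 0) :
    Phase (Fin n) ≃ᵐ Phase (Fin n) :=
  MeasurableEquiv.prodComm.trans
    ((MeasurableEquiv.smul₀ s hs).prodCongr (MeasurableEquiv.smul₀ t ht))

theorem scaleSwap_apply {s t : ℝ} (hs : s ≠ 0) (ht : t ≠ 0) (z : Phase (Fin n)) :
    scaleSwap n s t hs ht z = (s • z.2, t • z.1) := rfl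

theorem map_scaleSwap {s t : ℝ} (hs : s ≠ 0) (ht : t ≠ 0) :
    (volume : Measure (Phase (Fin n))).map (scaleSwap n s t hs ht) =
      ENNReal.ofReal (|s * t|⁻¹ ^ n) • volume := by
  have h1 : (scaleSwap n s t hs ht : Phase (Fin n) → Phase (Fin n)) =
      Prod.map (fun x => s • x) (fun x => t • x) ∘ Prod.swap := rfl
  rw [h1, ← Measure.map_map (by fun_prop) measurable_swap, Measure.volume_eq_prod,
    Measure.prod_swap, ← Measure.map_prod_map _ _ (by fun_prop) (by fun_prop),
    Measure.map_addHaar_smul _ hs, Measure.map_addHaar_smul _ ht, Measure.prod_smul_left,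
    Measure.prod_smul_right, smul_smul, ← ENNReal.ofReal_mul (by positivity), ← abs_mul]
  congr 2
  simp only [finrank_euclideanSpace_fin]
  rw [← mul_inv, ← mul_pow, abs_inv, abs_pow, inv_pow]

/-- A permutation of four blocks followed by the scalings `τ` and `1/τ`, whose Jacobians cancel. -/
theorem measurePreserving_pairs {τ : ℝ} (hτ : 0 < τ) :
    MeasurePreserving (fun p : Phase (Fin n ⊕ Fin n) => (firstPair p, secondPair τ p)) := by
  have e1 : MeasurePreserving (Prod.map halves halves :
      Phase (Fin n ⊕ Fin n) → Phase (Fin n) × Phase (Fin n)) :=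
    measurePreserving_halves.prod measurePreserving_halves
  have e3 : MeasurePreserving (scaleSwap n τ τ⁻¹ hτ.ne' (inv_ne_zero hτ.ne')) := by
    refine ⟨MeasurableEquiv.measurable _, ?_⟩
    rw [map_scaleSwap, mul_inv_cancel₀ hτ.ne']
    simp
  have hid : MeasurePreserving (id : Config (Fin n) → Config (Fin n)) := MeasurePreserving.id _
  have a1 : MeasurePreserving (MeasurableEquiv.prodAssoc :
      (Config (Fin n) × Config (Fin n)) × Phase (Fin n) ≃ᵐ _) :=
    measurePreserving_prodAssoc volume volume volume
  have a2 : MeasurePreserving (MeasurableEquiv.prodAssoc :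
      (Config (Fin n) × Config (Fin n)) × Config (Fin n) ≃ᵐ _) :=
    measurePreserving_prodAssoc volume volume volume
  have sw : MeasurePreserving (Prod.swap : Config (Fin n) × Config (Fin n) → _) :=
    Measure.measurePreserving_swap
  -- Reassociating and exchanging the middle blocks takes `((x₁, x₂), (y₁, y₂))` to `((x₁, y₁), (x₂,
  -- y₂))`.
  have e2 := a1.symm.comp (hid.prod (a2.comp ((sw.prod hid).comp (a2.symm)))) |>.comp a1
  exact ((MeasurePreserving.id volume).prod e3).comp (e2.comp e1)

end ChangeOfVariables

/-! ### The symbol map as a windowed Fourier transform: isometry and injectivity -/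

section Symbol

variable {n : ℕ}

/-- A product carries the sup norm and is not an inner product space, so Fourier transforms on the
phase space are taken on `DoubleConfig n` and transported through `halves`. -/
theorem fourier_comp_halves (u : Phase (Fin n) → ℂ) (w : DoubleConfig n) :
    𝓕 (u ∘ halves) w = ∫ z : Phase (Fin n), u z * Complex.exp (-(2 * Real.pi * Complex.I) *
      ((inner ℝ z.1 (halves w).1 + inner ℝ z.2 (halves w).2 : ℝ) : ℂ)) := by
  rw [Real.fourier_eq', ← measurePreserving_halves.integral_comp
    (halvesEquiv n).measurableEmbedding]
  refine integral_congr_ae (Filter.Eventually.of_forall fun v => ?_)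
  simp only [Function.comp, smul_eq_mul, inner_eq_halves]
  rw [mul_comm]
  congr 2
  push_cast
  ring

theorem integrable_comp_halves {u : Phase (Fin n) → ℂ} (h1 : Integrable u) :
    Integrable (u ∘ (halves : DoubleConfig n → _)) :=
  (measurePreserving_halves.integrable_comp h1.aestronglyMeasurable).2 h1

theorem memLp_comp_halves {u : Phase (Fin n) → ℂ} (h2 : MemLp u 2) :
    MemLp (u ∘ (halves : DoubleConfig n → _)) 2 :=
  h2.comp_measurePreserving measurePreserving_halves

theorem continuous_fourier_comp_halves {u : Phase (Fin n) → ℂ} (h1 : Integrable u) :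
    Continuous (𝓕 (u ∘ (halves : DoubleConfig n → _))) :=
  VectorFourier.fourierIntegral_continuous Real.continuous_fourierChar
    continuous_inner (integrable_comp_halves h1)

/-- Plancherel's formula for the symplectic Fourier transform. -/
theorem lintegral_enorm_symplectic_fourier_sq {h : ℝ} (hh : 0 < h) {u : Phase (Fin n) → ℂ}
    (h1 : Integrable u) (h2 : MemLp u 2) :
    ∫⁻ r : Phase (Fin n), ‖∫ z, u z *
        Complex.exp (2 * Real.pi * Complex.I * h * symplForm z r)‖ₑ ^ 2 =
      ENNReal.ofReal ((h⁻¹ ^ 2) ^ n) * ∫⁻ z, ‖u z‖ₑ ^ 2 := by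
  have hh' : -h ≠ 0 := by simpa using hh.ne'
  -- The exponent `2πiħ ω(z, r)` equals `-2πi ⟨z, κ r⟩` for `κ (r₁, r₂) = (-ħ r₂, ħ r₁)`. The
  -- Jacobian of `κ` gives the factor `ħ^{-2n}`.
  let κ := (scaleSwap n (-h) h hh' hh.ne')
  have e1 : ∀ r : Phase (Fin n), ∫ z, u z *
      Complex.exp (2 * Real.pi * Complex.I * h * symplForm z r) =
      𝓕 (u ∘ halves) ((halvesEquiv n).symm (κ r)) := by
    intro r
    rw [fourier_comp_halves]
    have : halves ((halvesEquiv n).symm (κ r)) = κ r := (halvesEquiv n).apply_symm_apply _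
    rw [this, scaleSwap_apply]
    refine integral_congr_ae (Filter.Eventually.of_forall fun z => ?_)
    simp only [inner_smul_right, symplForm, real_inner_comm r.1 z.2]
    congr 2
    push_cast
    ring
  simp_rw [e1]
  have hc := continuous_fourier_comp_halves h1
  have hmeas : Measurable fun q : Phase (Fin n) =>
      ‖𝓕 (u ∘ halves) ((halvesEquiv n).symm q)‖ₑ ^ 2 :=
    ((hc.measurable.comp (halvesEquiv n).symm.measurable).enorm).pow_const 2
  rw [← lintegral_map hmeas κ.measurable, map_scaleSwap, lintegral_smul_measure]
  rw [← measurePreserving_halves.lintegral_comp hmeas]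
  have : ∀ v : DoubleConfig n, (halvesEquiv n).symm (halves v) = v :=
    fun v => (halvesEquiv n).symm_apply_apply v
  simp_rw [this]
  rw [lintegral_enorm_fourier_sq (integrable_comp_halves h1) (memLp_comp_halves h2),
    ← (measurePreserving_halves (n := n)).lintegral_comp_emb (halvesEquiv n).measurableEmbedding
      (fun z => ‖u z‖ₑ ^ 2), smul_eq_mul]
  congr 3
  rw [neg_mul, abs_neg, abs_of_pos (by positivity)]
  field_simp

/-- Since `ω(r, r) = 0`, the only coupling of `z` and `r` is bilinear. This is what makes the kernel
a Fourier kernel in these coordinates. -/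
theorem symplForm_shift (c r z : Phase (Fin n)) :
    symplForm ((2 : ℝ) • z - (c - r)) r = 2 * symplForm z r - symplForm c r := by
  simp only [symplForm, Prod.fst_sub, Prod.snd_sub, Prod.smul_fst, Prod.smul_snd, inner_sub_left,
    inner_sub_right, inner_smul_left, inner_smul_right, conj_trivial]
  ring

/-- The kernel of the symbol map in the coordinates `c = firstPair p + secondPair τ p`,
`r = secondPair τ p`. -/
theorem leftAction_phaseGaussian_eq (h τ : ℝ) (c r z : Phase (Fin n)) :
    leftAction h ((2 : ℝ) • z - (c - r)) (phaseGaussian h τ) r =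
      Complex.exp (-(Real.pi * Complex.I * h * symplForm c r)) *
        (phaseGaussian h τ (c - (2 : ℝ) • z) *
          Complex.exp (2 * Real.pi * Complex.I * h * symplForm z r)) := by
  have : r - ((2 : ℝ) • z - (c - r)) = c - (2 : ℝ) • z := by abel
  rw [leftAction, this, symplForm_shift, mul_left_comm, ← Complex.exp_add, mul_comm]
  congr 2
  push_cast
  ring

theorem norm_leftAction_phaseGaussian (h τ : ℝ) (p q : Phase (Fin n)) :
    ‖leftAction h p (phaseGaussian h τ) q‖ = ‖phaseGaussian h τ (q - p)‖ := by
  rw [leftAction, norm_mul]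
  have : (Real.pi * Complex.I * h * symplForm p q : ℂ)
      = ((Real.pi * h * symplForm p q : ℝ) : ℂ) * Complex.I := by
    push_cast; ring
  rw [this, Complex.norm_exp_ofReal_mul_I, one_mul]

theorem continuous_leftAction_phaseGaussian (h τ : ℝ) :
    Continuous fun w : Phase (Fin n) × Phase (Fin n) =>
      leftAction h w.1 (phaseGaussian h τ) w.2 := by
  unfold leftAction
  refine Continuous.mul ?_ ((continuous_phaseGaussian h τ).comp (by fun_prop))
  have := continuous_symplForm (ι := Fin n)
  exact Complex.continuous_exp.comp
    (continuous_const.mul (Complex.continuous_ofReal.comp this))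

theorem integrable_symbol_integrand {h τ : ℝ} (hh : 0 < h) (hτ : 0 < τ)
    {ψ : Phase (Fin n) → ℂ} (hψ : MemLp ψ 2 ∨ MemLp ψ ∞) (p q : Phase (Fin n)) :
    Integrable (fun z => ψ z * leftAction h ((2 : ℝ) • z - p) (phaseGaussian h τ) q) := by
  have hm : AEStronglyMeasurable ψ := hψ.elim (fun h => h.1) (fun h => h.1)
  have h1 := integrable_mul_phaseGaussian_shift hh hτ hψ (q + p)
  refine h1.mono (hm.mul ?_) (Filter.Eventually.of_forall fun z => ?_)
  · have := (continuous_leftAction_phaseGaussian (n := n) h τ).comp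
      (f := fun z : Phase (Fin n) => ((2 : ℝ) • z - p, q)) (by fun_prop)
    exact this.aestronglyMeasurable
  · rw [norm_mul, norm_mul, norm_leftAction_phaseGaussian, sub_sub_eq_add_sub]

/-- The symplectic form is antisymmetric while the Gaussian is real and even. This yields the second
form of the symbol. -/
theorem leftAction_phaseGaussian_conj (h τ : ℝ) (p q : Phase (Fin n)) :
    leftAction h p (phaseGaussian h τ) q = conj (leftAction h q (phaseGaussian h τ) p) := by
  have h1 : symplForm q p = -symplForm p q := by
    simp only [symplForm]
    rw [real_inner_comm p.2, real_inner_comm q.2]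
    ring
  have h2 : conj (phaseGaussian h τ (p - q)) = phaseGaussian h τ (p - q) := by
    simp only [phaseGaussian, Complex.conj_ofReal]
  rw [leftAction, leftAction, map_mul, h2, phaseGaussian_sub_comm, h1, ← Complex.exp_conj]
  congr 2
  simp

theorem stronglyMeasurable_symbol_integral (h τ : ℝ) {ψ : Phase (Fin n) → ℂ}
    (hm : StronglyMeasurable ψ) :
    StronglyMeasurable fun w : Phase (Fin n) × Phase (Fin n) =>
      ∫ z, ψ z * leftAction h ((2 : ℝ) • z - w.1) (phaseGaussian h τ) w.2 := by
  refine StronglyMeasurable.integral_prod_right' (f := fun u : (Phase (Fin n) × Phase (Fin n)) ×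
    Phase (Fin n) => ψ u.2 *
      leftAction h ((2 : ℝ) • u.2 - u.1.1) (phaseGaussian h τ) u.1.2) ?_
  refine (hm.comp_measurable measurable_snd).mul ?_
  exact ((continuous_leftAction_phaseGaussian (n := n) h τ).comp
    (f := fun u : (Phase (Fin n) × Phase (Fin n)) × Phase (Fin n) =>
      ((2 : ℝ) • u.2 - u.1.1, u.1.2)) (by fun_prop)).stronglyMeasurable

/-- For fixed `c` the integral is, up to a unimodular factor, the symplectic Fourier transform at
`r` of `ψ` times a Gaussian window around `c/2`, so Plancherel applies in `r`. -/
theorem lintegral_enorm_symbol_slice {h τ : ℝ} (hh : 0 < h) (hτ : 0 < τ)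
    {ψ : Phase (Fin n) → ℂ} (hψ : MemLp ψ 2 ∨ MemLp ψ ∞) (c : Phase (Fin n)) :
    ∫⁻ r, ‖∫ z, ψ z * leftAction h ((2 : ℝ) • z - (c - r)) (phaseGaussian h τ) r‖ₑ ^ 2 =
      ENNReal.ofReal ((h⁻¹ ^ 2) ^ n) *
        ∫⁻ z, ‖ψ z‖ₑ ^ 2 * ‖phaseGaussian h τ (c - (2 : ℝ) • z)‖ₑ ^ 2 := by
  have key := lintegral_enorm_symplectic_fourier_sq hh
    (integrable_mul_phaseGaussian_shift hh hτ hψ c)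
    (memLp_two_mul_phaseGaussian_shift hh hτ hψ c)
  simp_rw [enorm_mul, mul_pow] at key
  rw [← key]
  refine lintegral_congr fun r => ?_
  simp only [leftAction_phaseGaussian_eq, mul_left_comm (ψ _) (Complex.exp (-_))]
  rw [integral_const_mul, enorm_mul]
  have : (-(Real.pi * Complex.I * h * symplForm c r) : ℂ)
      = ((-(Real.pi * h * symplForm c r) : ℝ) : ℂ) * Complex.I := by
    push_cast; ring
  rw [this, ← ofReal_norm (Complex.exp _), Complex.norm_exp_ofReal_mul_I, ENNReal.ofReal_one,
    one_mul]
  simp only [mul_assoc]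

/-- The shear `(q, r) ↦ (q + r, r)` preserves the measure. It introduces the coordinates in which
the window depends on `c` only. -/
theorem lintegral_pairs_eq {τ : ℝ} (hτ : 0 < τ) {H : Phase (Fin n) × Phase (Fin n) → ℝ≥0∞}
    (hH : Measurable H) :
    ∫⁻ p : Phase (Fin n ⊕ Fin n), H (firstPair p, secondPair τ p) =
      ∫⁻ c, ∫⁻ r, H (c - r, r) := by
  have hmeas : Measurable fun w : Phase (Fin n) × Phase (Fin n) => H (w.1 - w.2, w.2) :=
    hH.comp ((measurable_fst.sub measurable_snd).prodMk measurable_snd)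
  rw [(measurePreserving_pairs (n := n) hτ).lintegral_comp hH, Measure.volume_eq_prod,
    lintegral_prod_symm _ hH.aemeasurable,
    lintegral_lintegral_swap (f := fun c r => H (c - r, r)) hmeas.aemeasurable]
  exact lintegral_congr fun r => (lintegral_sub_right_eq_self (fun c => H (c, r)) r).symm

/-- The symbol map multiplies the square of the `L²` norm by `ħ^{3n}`. -/
theorem lintegral_enorm_toeplitzSymbol_sq {h τ : ℝ} (hh : 0 < h) (hτ : 0 < τ)
    {ψ : Phase (Fin n) → ℂ} (hm : StronglyMeasurable ψ) (hψ : MemLp ψ 2 ∨ MemLp ψ ∞) :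
    ∫⁻ p, ‖toeplitzSymbol h τ ψ p‖ₑ ^ 2 =
      ENNReal.ofReal (h ^ (3 * n)) * ∫⁻ z, ‖ψ z‖ₑ ^ 2 := by
  have hH := (stronglyMeasurable_symbol_integral (n := n) h τ hm).measurable.enorm.pow_const 2
  have e1 : ∀ p, ‖toeplitzSymbol h τ ψ p‖ₑ ^ 2 = ENNReal.ofReal ((h ^ 6) ^ n) *
      ‖∫ z, ψ z * leftAction h ((2 : ℝ) • z - firstPair p) (phaseGaussian h τ)
        (secondPair τ p)‖ₑ ^ 2 := by
    intro p
    simp only [toeplitzSymbol]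
    rw [enorm_mul, mul_pow, ← ofReal_norm, Complex.norm_real, Real.norm_of_nonneg (by positivity),
      ← ENNReal.ofReal_pow (by positivity)]
    congr 2
    ring
  simp_rw [e1]
  rw [lintegral_const_mul' _ _ ENNReal.ofReal_ne_top, lintegral_pairs_eq hτ hH]
  simp only [lintegral_enorm_symbol_slice hh hτ hψ]
  rw [lintegral_const_mul' _ _ ENNReal.ofReal_ne_top, lintegral_lintegral_swap]
  · have : ∀ z, ∫⁻ c, ‖ψ z‖ₑ ^ 2 * ‖phaseGaussian h τ (c - (2 : ℝ) • z)‖ₑ ^ 2 =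
        ENNReal.ofReal (h⁻¹ ^ n) * ‖ψ z‖ₑ ^ 2 := by
      intro z
      rw [lintegral_const_mul' _ _ (by simp), lintegral_enorm_phaseGaussian_sq hh hτ,
        Fintype.card_fin, mul_comm]
    simp_rw [this]
    -- Three powers of `ħ`, each raised to `n`, are collected: `ħ^6` from the squared prefactor,
    -- `ħ^{-2}` from Plancherel and `ħ^{-1}` from the squared norm of the window.
    rw [lintegral_const_mul' _ _ ENNReal.ofReal_ne_top, ← mul_assoc, ← mul_assoc,
      ← ENNReal.ofReal_mul (by positivity), ← ENNReal.ofReal_mul (by positivity), pow_mul,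
      ← mul_pow, ← mul_pow]
    congr 3
    field_simp
  · refine Measurable.aemeasurable (Measurable.fun_mul ?_ ?_)
    · exact (hm.measurable.comp measurable_snd).enorm.pow_const 2
    · exact (((continuous_phaseGaussian h τ).comp
        (f := fun u : Phase (Fin n) × Phase (Fin n) => u.1 - (2 : ℝ) • u.2)
        (by fun_prop)).measurable.enorm).pow_const 2

theorem continuous_pairs (τ : ℝ) :
    Continuous fun p : Phase (Fin n ⊕ Fin n) => (firstPair p, secondPair τ p) := by
  have h1 := (continuous_halves (n := n)).comp
    (continuous_fst (X := DoubleConfig n) (Y := DoubleConfig n))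
  have h2 := (continuous_halves (n := n)).comp
    (continuous_snd (X := DoubleConfig n) (Y := DoubleConfig n))
  exact (h1.fst.prodMk h2.fst).prodMk ((h2.snd.const_smul τ).prodMk (h1.snd.const_smul τ⁻¹))

theorem stronglyMeasurable_toeplitzSymbol (h τ : ℝ) {ψ : Phase (Fin n) → ℂ}
    (hm : StronglyMeasurable ψ) : StronglyMeasurable (toeplitzSymbol h τ ψ) := by
  exact ((stronglyMeasurable_symbol_integral h τ hm).comp_measurable
    (continuous_pairs τ).measurable).const_mul _

theorem toeplitzSymbol_congr (h τ : ℝ) {ψ φ : Phase (Fin n) → ℂ} (he : ψ =ᵐ[volume] φ) :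
    toeplitzSymbol h τ ψ = toeplitzSymbol h τ φ := by
  funext p
  simp only [toeplitzSymbol]
  congr 1
  exact integral_congr_ae (by filter_upwards [he] with z hz; rw [hz])

theorem toeplitzSymbol_sub {h τ : ℝ} (hh : 0 < h) (hτ : 0 < τ) {ψ φ : Phase (Fin n) → ℂ}
    (hψ : MemLp ψ 2 ∨ MemLp ψ ∞) (hφ : MemLp φ 2 ∨ MemLp φ ∞) :
    toeplitzSymbol h τ (ψ - φ) = toeplitzSymbol h τ ψ - toeplitzSymbol h τ φ := by
  funext p
  simp only [toeplitzSymbol, Pi.sub_apply, sub_mul]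
  rw [integral_sub (integrable_symbol_integrand hh hτ hψ _ _)
    (integrable_symbol_integrand hh hτ hφ _ _), mul_sub]

theorem toeplitzSymbol_add {h τ : ℝ} (hh : 0 < h) (hτ : 0 < τ) {ψ φ : Phase (Fin n) → ℂ}
    (hψ : MemLp ψ 2 ∨ MemLp ψ ∞) (hφ : MemLp φ 2 ∨ MemLp φ ∞) :
    toeplitzSymbol h τ (ψ + φ) = toeplitzSymbol h τ ψ + toeplitzSymbol h τ φ := by
  funext p
  simp only [toeplitzSymbol, Pi.add_apply, add_mul]
  rw [integral_add (integrable_symbol_integrand hh hτ hψ _ _)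
    (integrable_symbol_integrand hh hτ hφ _ _), mul_add]

theorem toeplitzSymbol_smul (h τ : ℝ) (r : ℂ) (ψ : Phase (Fin n) → ℂ) :
    toeplitzSymbol h τ (r • ψ) = r • toeplitzSymbol h τ ψ := by
  funext p
  simp only [toeplitzSymbol, Pi.smul_apply, smul_eq_mul, mul_assoc r]
  rw [integral_const_mul, mul_left_comm]

/-- A bounded function is determined by its symbol. -/
theorem toeplitzSymbol_injective {h τ : ℝ} (hh : 0 < h) (hτ : 0 < τ)
    (ψ₁ ψ₂ : Lp ℂ ∞ (volume : Measure (Phase (Fin n))))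
    (he : toeplitzSymbol h τ ψ₁ =ᵐ[volume] toeplitzSymbol h τ ψ₂) : ψ₁ = ψ₂ := by
  have hsub := toeplitzSymbol_sub hh hτ (Or.inr (Lp.memLp ψ₁)) (Or.inr (Lp.memLp ψ₂))
  have hm : StronglyMeasurable ((ψ₁ : Phase (Fin n) → ℂ) - (ψ₂ : Phase (Fin n) → ℂ)) :=
    (Lp.stronglyMeasurable ψ₁).sub (Lp.stronglyMeasurable ψ₂)
  -- The difference is bounded but need not be square integrable. The norm identity is an equality
  -- in `[0, ∞]`, so a vanishing symbol still forces it to vanish.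
  have h1 := lintegral_enorm_toeplitzSymbol_sq hh hτ hm
    (Or.inr ((Lp.memLp ψ₁).sub (Lp.memLp ψ₂)))
  have h0 : ∫⁻ p, ‖toeplitzSymbol h τ ((ψ₁ : Phase (Fin n) → ℂ) - (ψ₂ : Phase (Fin n) → ℂ)) p‖ₑ ^ 2 = 0 := by
    rw [hsub, lintegral_congr_ae (g := fun _ => 0), lintegral_zero]
    filter_upwards [he] with p hp
    simp [hp]
  rw [h0, eq_comm, mul_eq_zero, or_iff_right (by simp; positivity),
    lintegral_eq_zero_iff (hm.measurable.enorm.pow_const 2)] at h1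
  refine Lp.ext ?_
  filter_upwards [h1] with z hz
  simpa [sub_eq_zero] using hz

theorem eLpNorm_two_sq {X : Type*} [MeasurableSpace X] {μ : Measure X} (f : X → ℂ) :
    eLpNorm f 2 μ ^ 2 = ∫⁻ x, ‖f x‖ₑ ^ 2 ∂μ := by
  rw [eLpNorm_eq_lintegral_rpow_enorm_toReal (p := 2) (by norm_num) (by norm_num),
    ← ENNReal.rpow_natCast, ← ENNReal.rpow_mul]
  simp

theorem memLp_toeplitzSymbol {h τ : ℝ} (hh : 0 < h) (hτ : 0 < τ) (ψ : L2 (Phase (Fin n))) :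
    MemLp (toeplitzSymbol h τ ψ) 2 := by
  refine ⟨(stronglyMeasurable_toeplitzSymbol h τ (Lp.stronglyMeasurable ψ)).aestronglyMeasurable,
    ?_⟩
  have : eLpNorm (toeplitzSymbol h τ ψ) 2 volume ^ 2 < ∞ := by
    rw [eLpNorm_two_sq, lintegral_enorm_toeplitzSymbol_sq hh hτ (Lp.stronglyMeasurable ψ)
      (Or.inl (Lp.memLp ψ)), ← eLpNorm_two_sq]
    exact ENNReal.mul_lt_top ENNReal.ofReal_lt_top (ENNReal.pow_lt_top (Lp.eLpNorm_lt_top ψ))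
  simpa using this

/-- The symbol map on `L²`. -/
noncomputable def symbolMap {h τ : ℝ} (hh : 0 < h) (hτ : 0 < τ) :
    L2 (Phase (Fin n)) →ₗ[ℂ] L2 (Phase (Fin n ⊕ Fin n)) where
  toFun ψ := (memLp_toeplitzSymbol hh hτ ψ).toLp _
  map_add' ψ φ := by
    rw [← MemLp.toLp_add]
    refine MemLp.toLp_congr _ _ (Filter.Eventually.of_forall fun p => ?_)
    rw [toeplitzSymbol_congr h τ (Lp.coeFn_add ψ φ), toeplitzSymbol_add hh hτ
      (Or.inl (Lp.memLp ψ)) (Or.inl (Lp.memLp φ))]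
  map_smul' r ψ := by
    rw [RingHom.id_apply, ← MemLp.toLp_const_smul]
    refine MemLp.toLp_congr _ _ (Filter.Eventually.of_forall fun p => ?_)
    rw [toeplitzSymbol_congr h τ (Lp.coeFn_smul r ψ), toeplitzSymbol_smul]

theorem coeFn_symbolMap {h τ : ℝ} (hh : 0 < h) (hτ : 0 < τ) (ψ : L2 (Phase (Fin n))) :
    symbolMap hh hτ ψ =ᵐ[volume] toeplitzSymbol h τ ψ :=
  (memLp_toeplitzSymbol hh hτ ψ).coeFn_toLp

theorem norm_symbolMap_sq {h τ : ℝ} (hh : 0 < h) (hτ : 0 < τ) (ψ : L2 (Phase (Fin n))) :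
    ‖symbolMap hh hτ ψ‖ ^ 2 = h ^ (3 * n) * ‖ψ‖ ^ 2 := by
  rw [Lp.norm_def, Lp.norm_def, eLpNorm_congr_ae (coeFn_symbolMap hh hτ ψ), ← ENNReal.toReal_pow,
    ← ENNReal.toReal_pow, eLpNorm_two_sq, lintegral_enorm_toeplitzSymbol_sq hh hτ
      (Lp.stronglyMeasurable ψ) (Or.inl (Lp.memLp ψ)), ← eLpNorm_two_sq, ENNReal.toReal_mul,
    ENNReal.toReal_ofReal (by positivity)]

/-- A linear map between Hilbert spaces that is a multiple of an isometry has a bounded left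
inverse. -/
theorem exists_leftInverse_of_norm_sq {E F : Type*} [NormedAddCommGroup E] [InnerProductSpace ℂ E]
    [CompleteSpace E] [NormedAddCommGroup F] [InnerProductSpace ℂ F] [CompleteSpace F]
    (S : E →ₗ[ℂ] F) {k : ℝ} (hk : 0 < k) (hS : ∀ x, ‖S x‖ ^ 2 = k * ‖x‖ ^ 2) :
    ∃ R : F →L[ℂ] E, ∀ x, R (S x) = x := by
  let s : ℝ := Real.sqrt k
  have hs : 0 < s := Real.sqrt_pos.2 hk
  let T : E →ₗᵢ[ℂ] F := ⟨((s⁻¹ : ℝ) : ℂ) • S, fun x => by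
    rw [LinearMap.smul_apply, norm_smul, Complex.norm_real, Real.norm_of_nonneg (by positivity),
      ← sq_eq_sq₀ (by positivity) (by positivity), mul_pow, hS, inv_pow,
      Real.sq_sqrt hk.le, inv_mul_cancel_left₀ hk.ne']⟩
  -- For the isometry `T = s⁻¹ S` one has `T* T = 1`, hence `s⁻¹ T*` undoes `S = s T`.
  refine ⟨((s⁻¹ : ℝ) : ℂ) • T.toContinuousLinearMap.adjoint, fun x => ?_⟩
  have hT : S x = ((s : ℝ) : ℂ) • T x := by
    have : T x = ((s⁻¹ : ℝ) : ℂ) • S x := rfl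
    rw [this, smul_smul, ← Complex.ofReal_mul, mul_inv_cancel₀ hs.ne', Complex.ofReal_one, one_smul]
  rw [hT, map_smul, _root_.smul_apply, smul_smul, ← Complex.ofReal_mul,
    mul_inv_cancel₀ hs.ne', Complex.ofReal_one, one_smul]
  refine ext_inner_left ℂ fun y => ?_
  rw [ContinuousLinearMap.adjoint_inner_right]
  exact T.inner_map_map y x

end Symbol

/-! ### The heat flow: boundedness on `L²` and failure of a bounded left inverse -/

section Guillemin

variable {n : ℕ}

/-- The square root of the Gaussian is again one, with half the parameter; Cauchy–Schwarz below
splits the kernel this way. -/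
theorem enorm_phaseGaussian_half_sq (h τ : ℝ) (p : Phase (Fin n)) :
    ‖phaseGaussian (h / 2) τ p‖ₑ ^ 2 = ‖phaseGaussian h τ p‖ₑ := by
  rw [← ofReal_norm, ← ofReal_norm, ← ENNReal.ofReal_pow (norm_nonneg _), norm_phaseGaussian_sq,
    mul_div_cancel₀ h two_ne_zero]

theorem lintegral_enorm_phaseGaussian_shift {h τ : ℝ} (hh : 0 < h) (hτ : 0 < τ)
    (p : Phase (Fin n)) :
    ∫⁻ z : Phase (Fin n), ‖phaseGaussian h τ (p - (2 : ℝ) • z)‖ₑ =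
      ENNReal.ofReal (|((2 : ℝ) ^ Module.finrank ℝ (Phase (Fin n)))⁻¹| * (2 / h) ^ n) := by
  have h1 := memLp_one_iff_integrable.1 (memLp_phaseGaussian_shift_one (h := h) hh hτ p)
  rw [← ofReal_integral_norm_eq_lintegral_enorm h1]
  congr 1
  simp_rw [phaseGaussian_sub_comm h τ p]
  rw [Measure.integral_comp_smul volume (fun w : Phase (Fin n) => ‖phaseGaussian h τ (w - p)‖),
    integral_sub_right_eq_self (fun w : Phase (Fin n) => ‖phaseGaussian h τ w‖) p,
    integral_norm_phaseGaussian hh hτ, Fintype.card_fin, smul_eq_mul]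

theorem lintegral_enorm_phaseGaussian_sub {h τ : ℝ} (hh : 0 < h) (hτ : 0 < τ)
    (q : Phase (Fin n)) :
    ∫⁻ p : Phase (Fin n), ‖phaseGaussian h τ (p - q)‖ₑ = ENNReal.ofReal ((2 / h) ^ n) := by
  rw [lintegral_sub_right_eq_self (fun p : Phase (Fin n) => ‖phaseGaussian h τ p‖ₑ) q,
    ← ofReal_integral_norm_eq_lintegral_enorm (integrable_phaseGaussian hh hτ),
    integral_norm_phaseGaussian hh hτ, Fintype.card_fin]

theorem stronglyMeasurable_guilleminSymbol (h τ : ℝ) {ψ : Phase (Fin n) → ℂ}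
    (hm : StronglyMeasurable ψ) : StronglyMeasurable (guilleminSymbol h τ ψ) := by
  refine StronglyMeasurable.const_mul ?_ _
  refine StronglyMeasurable.integral_prod_right' (f := fun u : Phase (Fin n) ×
    Phase (Fin n) => ψ u.2 * phaseGaussian h τ (u.1 - (2 : ℝ) • u.2)) ?_
  refine (hm.comp_measurable measurable_snd).mul ?_
  exact ((continuous_phaseGaussian h τ).comp
    (f := fun u : Phase (Fin n) × Phase (Fin n) => u.1 - (2 : ℝ) • u.2)
    (by fun_prop)).stronglyMeasurable

theorem guilleminSymbol_congr (h τ : ℝ) {ψ φ : Phase (Fin n) → ℂ} (he : ψ =ᵐ[volume] φ) :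
    guilleminSymbol h τ ψ = guilleminSymbol h τ φ := by
  funext p
  simp only [guilleminSymbol]
  congr 1
  exact integral_congr_ae (by filter_upwards [he] with z hz; rw [hz])

/-- The pointwise half of Schur's test: Cauchy–Schwarz applied to `|ψ| Φ^{1/2}` and `Φ^{1/2}`, with
the total mass of the kernel in `z` as the constant. -/
theorem enorm_integral_mul_phaseGaussian_sq_le {h τ : ℝ} (hh : 0 < h) (hτ : 0 < τ)
    {ψ : Phase (Fin n) → ℂ} (hm : StronglyMeasurable ψ) (p : Phase (Fin n)) :
    ‖∫ z, ψ z * phaseGaussian h τ (p - (2 : ℝ) • z)‖ₑ ^ 2 ≤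
      (∫⁻ z, ‖ψ z‖ₑ ^ 2 * ‖phaseGaussian h τ (p - (2 : ℝ) • z)‖ₑ) *
        ENNReal.ofReal (|((2 : ℝ) ^ Module.finrank ℝ (Phase (Fin n)))⁻¹| * (2 / h) ^ n) := by
  have hg : Measurable fun z : Phase (Fin n) => ‖phaseGaussian (h / 2) τ (p - (2 : ℝ) • z)‖ₑ :=
    ((continuous_phaseGaussian (h / 2) τ).comp (f := fun z : Phase (Fin n) => p - (2 : ℝ) • z)
      (by fun_prop)).measurable.enorm
  have hf : Measurable fun z => ‖ψ z‖ₑ * ‖phaseGaussian (h / 2) τ (p - (2 : ℝ) • z)‖ₑ :=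
    hm.measurable.enorm.mul hg
  have cs := ENNReal.lintegral_mul_le_Lp_mul_Lq volume Real.HolderConjugate.two_two
    hf.aemeasurable hg.aemeasurable
  have cs2 := pow_le_pow_left₀ (zero_le) cs 2
  rw [mul_pow, ← ENNReal.rpow_natCast (_ ^ (1 / (2 : ℝ))), ← ENNReal.rpow_natCast (_ ^ (1 / (2 : ℝ))),
    ← ENNReal.rpow_mul, ← ENNReal.rpow_mul] at cs2
  simp only [Pi.mul_apply, ENNReal.rpow_ofNat, mul_pow, Nat.cast_ofNat, one_div, mul_assoc,
    ne_eq, OfNat.ofNat_ne_zero, not_false_eq_true, inv_mul_cancel₀, ENNReal.rpow_one, ← sq,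
    enorm_phaseGaussian_half_sq, lintegral_enorm_phaseGaussian_shift hh hτ] at cs2
  refine le_trans (pow_le_pow_left₀ zero_le (enorm_integral_le_lintegral_enorm _) 2) ?_
  simpa only [enorm_mul] using cs2

/-- The heat flow maps `L²` into itself. -/
theorem memLp_guilleminSymbol {h τ : ℝ} (hh : 0 < h) (hτ : 0 < τ) {ψ : Phase (Fin n) → ℂ}
    (hm : StronglyMeasurable ψ) (hψ : MemLp ψ 2) : MemLp (guilleminSymbol h τ ψ) 2 := by
  refine ⟨(stronglyMeasurable_guilleminSymbol h τ hm).aestronglyMeasurable, ?_⟩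
  have hψ2 : ∫⁻ z, ‖ψ z‖ₑ ^ 2 ≠ ∞ := by
    rw [← eLpNorm_two_sq]
    exact ENNReal.pow_ne_top hψ.eLpNorm_ne_top
  have key : eLpNorm (guilleminSymbol h τ ψ) 2 volume ^ 2 < ∞ := by
    rw [eLpNorm_two_sq]
    simp only [guilleminSymbol, enorm_mul, mul_pow]
    rw [lintegral_const_mul' _ _ (by simp)]
    refine ENNReal.mul_lt_top (by simp) ?_
    refine (lintegral_mono fun p => enorm_integral_mul_phaseGaussian_sq_le hh hτ hm p).trans_lt ?_
    -- The other half of Schur's test: the mass of the kernel in `p` does not depend on `z`.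
    rw [lintegral_mul_const' _ _ ENNReal.ofReal_ne_top, lintegral_lintegral_swap]
    · refine ENNReal.mul_lt_top ?_ ENNReal.ofReal_lt_top
      have : ∀ z, ∫⁻ p, ‖ψ z‖ₑ ^ 2 * ‖phaseGaussian h τ (p - (2 : ℝ) • z)‖ₑ =
          ‖ψ z‖ₑ ^ 2 * ENNReal.ofReal ((2 / h) ^ n) := fun z => by
        rw [lintegral_const_mul' _ _ (by simp), lintegral_enorm_phaseGaussian_sub hh hτ]
      simp_rw [this]
      rw [lintegral_mul_const' _ _ ENNReal.ofReal_ne_top]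
      exact ENNReal.mul_lt_top hψ2.lt_top ENNReal.ofReal_lt_top
    · refine Measurable.aemeasurable (Measurable.fun_mul ?_ ?_)
      · exact (hm.measurable.comp measurable_snd).enorm.pow_const 2
      · exact ((continuous_phaseGaussian h τ).comp
          (f := fun u : Phase (Fin n) × Phase (Fin n) => u.1 - (2 : ℝ) • u.2)
          (by fun_prop)).measurable.enorm
  simpa using key

/-- The heat flow sends highly oscillating functions to small ones. -/
theorem tendsto_lintegral_guilleminSymbol_sq {h τ : ℝ} (hh : 0 < h) (hτ : 0 < τ)
    (w : ℕ → StrongDual ℝ (Phase (Fin n)))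
    (hw : Filter.Tendsto w Filter.atTop (Filter.cocompact _)) :
    Filter.Tendsto (fun k => ∫⁻ p, ‖guilleminSymbol h τ (fun z : Phase (Fin n) =>
      (Real.fourierChar (-(w k) z) : ℂ) * phaseGaussian h τ (0 - (2 : ℝ) • z)) p‖ₑ ^ 2)
      Filter.atTop (𝓝 0) := by
  have hc : Continuous (fun z : Phase (Fin n) => phaseGaussian h τ (0 - (2 : ℝ) • z)) :=
    (continuous_phaseGaussian h τ).comp (by fun_prop)
  have hD := memLp_guilleminSymbol hh hτ hc.stronglyMeasurable
    (memLp_phaseGaussian_shift_two hh hτ 0)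
  have hsm : ∀ k, StronglyMeasurable fun z : Phase (Fin n) =>
      (Real.fourierChar (-(w k) z) : ℂ) * phaseGaussian h τ (0 - (2 : ℝ) • z) := fun k =>
    ((continuous_subtype_val.comp (Real.continuous_fourierChar.comp
      (-(w k)).continuous)).mul hc).stronglyMeasurable
  have hlim : ∀ p, Filter.Tendsto (fun k => ‖guilleminSymbol h τ (fun z : Phase (Fin n) =>
      (Real.fourierChar (-(w k) z) : ℂ) * phaseGaussian h τ (0 - (2 : ℝ) • z)) p‖ₑ ^ 2)
      Filter.atTop (𝓝 0) := by
    intro p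
    -- For fixed `p` this is the Riemann–Lebesgue lemma.
    have h1 := (tendsto_integral_exp_smul_cocompact (fun z : Phase (Fin n) =>
      phaseGaussian h τ (0 - (2 : ℝ) • z) * phaseGaussian h τ (p - (2 : ℝ) • z)) volume).comp hw
    have h2 := ENNReal.Tendsto.pow (n := 2) (h1.const_mul ((h ^ (2 * n) : ℝ) : ℂ)).enorm
    simp only [mul_zero, enorm_zero, ne_eq, OfNat.ofNat_ne_zero, not_false_eq_true,
      zero_pow] at h2
    refine h2.congr fun k => ?_
    simp only [guilleminSymbol, Function.comp, Circle.smul_def, smul_eq_mul, mul_assoc]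
  have := tendsto_lintegral_of_dominated_convergence
    (μ := (volume : Measure (Phase (Fin n)))) (f := fun _ => 0)
    (fun p => ‖guilleminSymbol h τ (fun z : Phase (Fin n) =>
      phaseGaussian h τ (0 - (2 : ℝ) • z)) p‖ₑ ^ 2)
    (fun k => (stronglyMeasurable_guilleminSymbol h τ (hsm k)).measurable.enorm.pow_const 2)
    (fun k => Filter.Eventually.of_forall fun p => ?_) ?_
    (Filter.Eventually.of_forall hlim)
  · simpa using this
  · refine pow_le_pow_left₀ zero_le ?_ 2
    simp only [guilleminSymbol, enorm_mul]
    refine mul_le_mul_right ?_ _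
    rw [enorm_le_iff_norm_le]
    refine (norm_integral_le_integral_norm _).trans (le_of_eq ?_)
    -- Gaussians are positive, so removing the modulation by taking norms gives exactly the image of
    -- the unmodulated Gaussian. That image is a square integrable dominating function.
    have : ∀ z : Phase (Fin n),
        phaseGaussian h τ (0 - (2 : ℝ) • z) * phaseGaussian h τ (p - (2 : ℝ) • z) =
        ((‖(Real.fourierChar (-(w k) z) : ℂ) * phaseGaussian h τ (0 - (2 : ℝ) • z) *
          phaseGaussian h τ (p - (2 : ℝ) • z)‖ : ℝ) : ℂ) := by
      intro z
      simp only [norm_mul, Circle.norm_coe, one_mul, phaseGaussian, Complex.norm_real,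
        Real.norm_eq_abs, Real.abs_exp, Complex.ofReal_mul]
    simp_rw [this]
    rw [integral_complex_ofReal, Complex.norm_real, Real.norm_of_nonneg]
    exact integral_nonneg fun _ => norm_nonneg _
  · rw [← eLpNorm_two_sq]
    exact ENNReal.pow_ne_top hD.eLpNorm_ne_top

/-- The heat flow has no bounded left inverse on `L²`. -/
theorem not_exists_leftInverse_guilleminSymbol (hn : 0 < n) {h τ : ℝ} (hh : 0 < h) (hτ : 0 < τ) :
    ¬ ∃ R : L2 (Phase (Fin n)) →L[ℂ] L2 (Phase (Fin n)),
      ∀ ψ a : L2 (Phase (Fin n)), a =ᵐ[volume] guilleminSymbol h τ ψ → R a = ψ := by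
  rintro ⟨R, hR⟩
  -- Here `n ≥ 1` enters: a nonzero frequency exists, and its multiples leave every compact set.
  let w₀ : StrongDual ℝ (Phase (Fin n)) :=
    (EuclideanSpace.proj (𝕜 := ℝ) (⟨0, hn⟩ : Fin n)).comp (ContinuousLinearMap.fst ℝ _ _)
  have hw₀ : w₀ ≠ 0 := by
    intro h0
    have := congrArg (fun v => v (EuclideanSpace.single ⟨0, hn⟩ 1, 0)) h0
    simp [w₀] at this
  let w : ℕ → StrongDual ℝ (Phase (Fin n)) := fun k => (k : ℝ) • w₀
  have hw : Filter.Tendsto w Filter.atTop (Filter.cocompact _) := by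
    rw [← Metric.cobounded_eq_cocompact, ← tendsto_norm_atTop_iff_cobounded]
    simp only [w, norm_smul, Real.norm_natCast]
    exact tendsto_natCast_atTop_atTop.atTop_mul_const (norm_pos_iff.2 hw₀)
  have hc : Continuous (fun z : Phase (Fin n) => phaseGaussian h τ (0 - (2 : ℝ) • z)) :=
    (continuous_phaseGaussian h τ).comp (by fun_prop)
  let ψ : ℕ → Phase (Fin n) → ℂ := fun k z =>
    (Real.fourierChar (-(w k) z) : ℂ) * phaseGaussian h τ (0 - (2 : ℝ) • z)
  have hψc : ∀ k, Continuous (ψ k) := fun k =>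
    (continuous_subtype_val.comp (Real.continuous_fourierChar.comp (-(w k)).continuous)).mul hc
  have hnorm : ∀ k z, ‖ψ k z‖ = ‖phaseGaussian h τ (0 - (2 : ℝ) • z)‖ := fun k z => by
    simp only [ψ, norm_mul, Circle.norm_coe, one_mul]
  have hG2 := memLp_phaseGaussian_shift_two (ι := Fin n) hh hτ 0
  have hψ : ∀ k, MemLp (ψ k) 2 := fun k =>
    hG2.of_le (hψc k).aestronglyMeasurable (Filter.Eventually.of_forall fun z => (hnorm k z).le)
  have hψn : ∀ k, ‖(hψ k).toLp _‖ = ‖hG2.toLp _‖ := fun k => by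
    rw [Lp.norm_toLp, Lp.norm_toLp]
    exact congrArg _ (eLpNorm_congr_norm_ae (Filter.Eventually.of_forall (hnorm k)))
  have ha : ∀ k, MemLp (guilleminSymbol h τ (ψ k)) 2 := fun k =>
    memLp_guilleminSymbol hh hτ (hψc k).stronglyMeasurable (hψ k)
  have hRa : ∀ k, R ((ha k).toLp _) = (hψ k).toLp _ := fun k =>
    hR _ _ (by rw [guilleminSymbol_congr h τ (hψ k).coeFn_toLp]; exact (ha k).coeFn_toLp)
  have hbound : ∀ k, ‖hG2.toLp _‖ ^ 2 ≤ ‖R‖ ^ 2 * ‖(ha k).toLp _‖ ^ 2 := fun k => by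
    rw [← hψn k, ← hRa k, ← mul_pow]
    exact pow_le_pow_left₀ (norm_nonneg _) (R.le_opNorm _) 2
  have hlim := (ENNReal.tendsto_toReal ENNReal.zero_ne_top).comp
    (tendsto_lintegral_guilleminSymbol_sq hh hτ w hw)
  have hlim2 : Filter.Tendsto (fun k => ‖(ha k).toLp _‖ ^ 2) Filter.atTop (𝓝 0) := by
    refine hlim.congr fun k => ?_
    rw [Function.comp, ← eLpNorm_two_sq, ENNReal.toReal_pow, Lp.norm_toLp]
  -- The left side of `hbound` is independent of `k` and the right side tends to zero, so the
  -- Gaussian itself would vanish.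
  have hle := ge_of_tendsto' (hlim2.const_mul (‖R‖ ^ 2)) hbound
  rw [mul_zero] at hle
  have hz : hG2.toLp _ = 0 := by
    rw [← norm_eq_zero]
    exact pow_eq_zero_iff two_ne_zero |>.1 (le_antisymm hle (by positivity))
  rw [← MemLp.toLp_zero (MemLp.zero' : MemLp (fun _ => (0 : ℂ)) 2 _), MemLp.toLp_eq_toLp_iff] at hz
  have := (Continuous.ae_eq_iff_eq volume hc continuous_const).1 hz
  exact phaseGaussian_ne_zero h τ _ (congrFun this 0)

end Guillemin

/-! ### Matrix coefficients of the Schrödinger representation: decay and symplectic Fourier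
transform -/

section MatrixCoefficients

variable {ι : Type} [Fintype ι]

theorem SchwartzMap.exists_norm_le_one_add_norm_rpow {E : Type*} [NormedAddCommGroup E]
    [NormedSpace ℝ E] (f : 𝓢(E, ℂ)) (k : ℕ) :
    ∃ C : ℝ, 0 ≤ C ∧ ∀ x, ‖f x‖ ≤ C * (1 + ‖x‖) ^ (-(k : ℝ)) := by
  refine ⟨2 ^ k * (Finset.Iic (k, 0)).sup (fun m => SchwartzMap.seminorm ℝ m.1 m.2) f,
    by positivity, fun x => ?_⟩
  have h := SchwartzMap.one_add_le_sup_seminorm_apply (𝕜 := ℝ) (m := (k, 0)) le_rfl le_rfl f x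
  rw [norm_iteratedFDeriv_zero] at h
  rw [Real.rpow_neg (by positivity), Real.rpow_natCast, ← div_eq_mul_inv,
    le_div_iff₀ (by positivity), mul_comm]
  exact h

/-- Peetre's inequality: `1 + ‖x‖ ≤ (1 + ‖t - x‖)(1 + ‖t‖)`, raised to a nonpositive power. -/
theorem one_add_norm_rpow_mul_le {E : Type*} [NormedAddCommGroup E] (x t : E) {r : ℝ}
    (hr : 0 ≤ r) :
    (1 + ‖t - x‖) ^ (-r) * (1 + ‖t‖) ^ (-r) ≤ (1 + ‖x‖) ^ (-r) := by
  rw [← Real.mul_rpow (by positivity) (by positivity)]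
  refine Real.rpow_le_rpow_of_nonpos (by positivity) ?_ (by linarith)
  have : ‖x‖ ≤ ‖t - x‖ + ‖t‖ := by
    have := norm_sub_le t (t - x)
    rw [sub_sub_cancel] at this
    linarith
  nlinarith [norm_nonneg (t - x), norm_nonneg t, mul_nonneg (norm_nonneg (t - x)) (norm_nonneg t)]

/-- The correlation of two Schwartz functions decays rapidly. -/
theorem exists_integral_norm_mul_norm_le (f g : 𝓢(Config ι, ℂ)) (k : ℕ) :
    ∃ C : ℝ, 0 ≤ C ∧ ∀ x, ∫ t, ‖f (t - x)‖ * ‖g t‖ ≤ C * (1 + ‖x‖) ^ (-(k : ℝ)) := by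
  obtain ⟨Cf, hCf, hf⟩ := f.exists_norm_le_one_add_norm_rpow k
  let M : ℕ := Module.finrank ℝ (Config ι) + 1
  -- Of the powers of decay of `g`, `k` are spent on Peetre's inequality and `M`, one more than the
  -- dimension, on integrability in `t`.
  obtain ⟨Cg, hCg, hg⟩ := g.exists_norm_le_one_add_norm_rpow (k + M)
  have hint : Integrable (fun t : Config ι => (1 + ‖t‖) ^ (-(M : ℝ))) :=
    integrable_one_add_norm (by simp [M])
  refine ⟨Cf * Cg * ∫ t : Config ι, (1 + ‖t‖) ^ (-(M : ℝ)), by positivity, fun x => ?_⟩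
  rw [mul_right_comm, ← integral_const_mul]
  refine integral_mono_of_nonneg (Filter.Eventually.of_forall fun t => by positivity)
    (hint.const_mul _) (Filter.Eventually.of_forall fun t => ?_)
  simp only
  calc ‖f (t - x)‖ * ‖g t‖
      ≤ (Cf * (1 + ‖t - x‖) ^ (-(k : ℝ))) * (Cg * (1 + ‖t‖) ^ (-((k + M : ℕ) : ℝ))) :=
        mul_le_mul (hf _) (hg _) (norm_nonneg _) (by positivity)
    _ = Cf * Cg * ((1 + ‖t - x‖) ^ (-(k : ℝ)) * (1 + ‖t‖) ^ (-(k : ℝ))) *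
          (1 + ‖t‖) ^ (-(M : ℝ)) := by
        rw [Nat.cast_add, neg_add, Real.rpow_add (by positivity)]
        ring
    _ ≤ Cf * Cg * (1 + ‖x‖) ^ (-(k : ℝ)) * (1 + ‖t‖) ^ (-(M : ℝ)) := by
        gcongr
        exact one_add_norm_rpow_mul_le x t (by positivity)

theorem cexp_pi_I_eq (h s : ℝ) :
    (Real.pi * Complex.I * h * s : ℂ) = ((Real.pi * h * s : ℝ) : ℂ) * Complex.I := by
  push_cast; ring

theorem norm_cexp_pi_I (h s : ℝ) : ‖Complex.exp (Real.pi * Complex.I * h * s)‖ = 1 := by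
  rw [cexp_pi_I_eq, Complex.norm_exp_ofReal_mul_I]

theorem norm_schrodinger (h : ℝ) (p : Phase ι) (f : Config ι → ℂ) (t : Config ι) :
    ‖schrodinger h p f t‖ = ‖f (t - p.1)‖ := by
  rw [schrodinger, norm_mul, norm_cexp_pi_I, one_mul]

theorem norm_matrixCoeff_le_fst (h : ℝ) (f g : Config ι → ℂ) (p : Phase ι) :
    ‖matrixCoeff h f g p‖ ≤ ∫ t, ‖f (t - p.1)‖ * ‖g t‖ := by
  refine (norm_integral_le_integral_norm _).trans (le_of_eq ?_)
  simp only [norm_mul, norm_schrodinger, RCLike.norm_conj]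

/-- On the Fourier side the modulation by `y` becomes a translation by a multiple of `h • y`. The
decay in `y` is thus a correlation bound for the Fourier transforms, just as the decay in `x` is one
for the functions themselves. -/
theorem norm_matrixCoeff_le_snd (h : ℝ) (f g : 𝓢(Config ι, ℂ)) (p : Phase ι) :
    ‖matrixCoeff h f g p‖ ≤ ∫ ξ, ‖(𝓕 f) (ξ - (-(h • p.2)))‖ * ‖(𝓕 g) ξ‖ := by
  -- Chosen so that the Fourier transform of `u` is the translate of `f`, while `v` holds the
  -- modulation and `conj g`; then `∫ û v = ∫ u v̂`.
  let u : Config ι → ℂ := fun ξ =>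
    Complex.exp ((2 * Real.pi * (inner ℝ ξ p.1 : ℝ) : ℝ) * Complex.I) * (𝓕 f) (-ξ)
  let v : Config ι → ℂ := fun t =>
    Complex.exp ((-2 * Real.pi * h * (inner ℝ p.2 t : ℝ) : ℝ) * Complex.I) * conj (g t)
  have hu : Integrable u := by
    refine ((𝓕 f).integrable.comp_neg).bdd_mul (c := 1) ?_
      (Filter.Eventually.of_forall fun ξ => ?_)
    · exact Continuous.aestronglyMeasurable (by fun_prop)
    · rw [Complex.norm_exp_ofReal_mul_I]
  have hv : Integrable v := by
    refine Integrable.bdd_mul (c := 1) ?_ ?_ (Filter.Eventually.of_forall fun ξ => ?_)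
    · exact (Complex.conjCLE.integrable_comp_iff).2 g.integrable
    · exact Continuous.aestronglyMeasurable (by fun_prop)
    · rw [Complex.norm_exp_ofReal_mul_I]
  have hflip : ∫ t, 𝓕 u t • v t = ∫ ξ, u ξ • 𝓕 v ξ := by
    simpa using! (VectorFourier.integral_fourierIntegral_smul_eq_flip (L := innerₗ (Config ι))
      Real.continuous_fourierChar continuous_inner hu hv)
  have hFu : ∀ t, 𝓕 u t = f (t - p.1) := by
    intro t
    have h1 : f (t - p.1) = 𝓕⁻ (𝓕 (f : Config ι → ℂ)) (t - p.1) := by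
      rw [f.continuous.fourierInv_fourier_eq f.integrable (𝓕 f).integrable]
    rw [h1, Real.fourierInv_eq', Real.fourier_eq', ← integral_neg_eq_self]
    refine integral_congr_ae (Filter.Eventually.of_forall fun ξ => ?_)
    simp only [u, smul_eq_mul, neg_neg, inner_neg_left, inner_sub_right]
    rw [← mul_assoc, ← Complex.exp_add]
    congr 2
    push_cast
    ring
  have hFv : ∀ ξ, ‖𝓕 v ξ‖ = ‖(𝓕 g) (-(ξ + h • p.2))‖ := by
    intro ξ
    have : 𝓕 v ξ = conj (𝓕 (g : Config ι → ℂ) (-(ξ + h • p.2))) := by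
      rw [Real.fourier_eq', Real.fourier_eq', ← integral_conj]
      refine integral_congr_ae (Filter.Eventually.of_forall fun t => ?_)
      simp only [v, smul_eq_mul, map_mul, ← Complex.exp_conj, Complex.conj_ofReal, Complex.conj_I,
        inner_neg_right, inner_add_right, inner_smul_right, real_inner_comm t p.2]
      rw [← mul_assoc, ← Complex.exp_add]
      congr 2
      push_cast
      ring
    rw [this, RCLike.norm_conj]
    rfl
  have hV : ‖matrixCoeff h f g p‖ = ‖∫ t, 𝓕 u t • v t‖ := by
    rw [← one_mul ‖∫ t, 𝓕 u t • v t‖, ← norm_cexp_pi_I h (inner ℝ p.1 p.2), ← norm_mul,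
      ← integral_const_mul]
    congr 1
    refine integral_congr_ae (Filter.Eventually.of_forall fun t => ?_)
    simp only [hFu, v, schrodinger, smul_eq_mul]
    have : (Real.pi * Complex.I * h * ((-2 * inner ℝ p.2 t + inner ℝ p.1 p.2 : ℝ) : ℂ)) =
        (Real.pi * Complex.I * h * (inner ℝ p.1 p.2 : ℝ) : ℂ) +
        ((-2 * Real.pi * h * (inner ℝ p.2 t : ℝ) : ℝ) * Complex.I : ℂ) := by
      push_cast; ring
    rw [this, Complex.exp_add]
    ring
  rw [hV, hflip]
  refine (norm_integral_le_integral_norm _).trans (le_of_eq ?_)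
  rw [← integral_sub_right_eq_self _ (h • p.2), ← integral_neg_eq_self]
  refine integral_congr_ae (Filter.Eventually.of_forall fun ξ => ?_)
  simp only [u, norm_smul, norm_mul, Complex.norm_exp_ofReal_mul_I, one_mul, hFv,
    sub_add_cancel, neg_neg, neg_sub, sub_neg_eq_add, add_comm (h • p.2)]

theorem continuous_schrodinger (h : ℝ) {f : Config ι → ℂ} (hf : Continuous f) :
    Continuous fun u : Phase ι × Config ι => schrodinger h u.1 f u.2 := by
  unfold schrodinger
  fun_prop

theorem stronglyMeasurable_matrixCoeff (h : ℝ) {f g : Config ι → ℂ} (hf : Continuous f)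
    (hg : Continuous g) : StronglyMeasurable (matrixCoeff h f g) := by
  refine StronglyMeasurable.integral_prod_right' (f := fun u : Phase ι × Config ι =>
    schrodinger h u.1 f u.2 * conj (g u.2)) ?_
  exact ((continuous_schrodinger h hf).mul
    (Complex.continuous_conj.comp (hg.comp continuous_snd))).stronglyMeasurable

theorem integrable_one_add_norm_smul {h : ℝ} (hh : 0 < h) {k : ℕ}
    (hk : Module.finrank ℝ (Config ι) < k) :
    Integrable (fun y : Config ι => (1 + ‖h • y‖) ^ (-(k : ℝ))) :=
  (integrable_one_add_norm (E := Config ι) (by exact_mod_cast hk)).comp_smul hh.ne'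

theorem exists_norm_matrixCoeff_le_snd (h : ℝ) (f g : 𝓢(Config ι, ℂ)) (k : ℕ) :
    ∃ C : ℝ, 0 ≤ C ∧ ∀ p, ‖matrixCoeff h f g p‖ ≤ C * (1 + ‖h • p.2‖) ^ (-(k : ℝ)) := by
  obtain ⟨C, hC, hB⟩ := exists_integral_norm_mul_norm_le (𝓕 f) (𝓕 g) k
  refine ⟨C, hC, fun p => (norm_matrixCoeff_le_snd h f g p).trans ?_⟩
  simpa only [norm_neg] using hB (-(h • p.2))

/-- The matrix coefficients of the Schrödinger representation at Schwartz functions are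
integrable. -/
theorem integrable_matrixCoeff {h : ℝ} (hh : 0 < h) (f g : 𝓢(Config ι, ℂ)) :
    Integrable (matrixCoeff h f g) := by
  let M : ℕ := Module.finrank ℝ (Config ι) + 1
  -- Each bound decays in one variable only. Their geometric mean decays in both with half the
  -- order, hence `M + M`.
  obtain ⟨C₁, hC₁, hA⟩ := exists_integral_norm_mul_norm_le f g (M + M)
  obtain ⟨C₂, hC₂, hB⟩ := exists_norm_matrixCoeff_le_snd h f g (M + M)
  have hi₁ : Integrable (fun x : Config ι => (1 + ‖x‖) ^ (-(M : ℝ))) :=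
    integrable_one_add_norm (by simp [M])
  have hi₂ := integrable_one_add_norm_smul (ι := ι) hh (k := M) (by simp [M])
  refine ((hi₁.mul_prod hi₂).const_mul (Real.sqrt (C₁ * C₂))).mono'
    (stronglyMeasurable_matrixCoeff h f.continuous g.continuous).aestronglyMeasurable
    (Filter.Eventually.of_forall fun p => ?_)
  have h1 := (norm_matrixCoeff_le_fst h f g p).trans (hA p.1)
  have h2 := hB p
  simp only [Nat.cast_add, neg_add] at h1 h2
  rw [Real.rpow_add (by positivity)] at h1 h2
  refine abs_le_of_sq_le_sq' ?_ (by positivity) |>.2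
  rw [mul_pow, Real.sq_sqrt (by positivity), sq]
  calc ‖matrixCoeff h f g p‖ * ‖matrixCoeff h f g p‖ ≤ _ :=
        mul_le_mul h1 h2 (norm_nonneg _) (by positivity)
    _ = _ := by ring

/-- Centring the integral at the midpoint, `t = s + x/2`, cancels the phase `exp(πiħ x·y)` and
leaves a plain Fourier integral in `s`. -/
theorem matrixCoeff_eq_fourier (h : ℝ) (f g : Config ι → ℂ) (x y : Config ι) :
    matrixCoeff h f g (x, y) =
      𝓕 (fun s => f (s - (2⁻¹ : ℝ) • x) * conj (g (s + (2⁻¹ : ℝ) • x))) (h • y) := by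
  rw [matrixCoeff, ← integral_add_right_eq_self _ ((2⁻¹ : ℝ) • x), Real.fourier_eq']
  refine integral_congr_ae (Filter.Eventually.of_forall fun s => ?_)
  have e1 : s + (2⁻¹ : ℝ) • x - x = s - (2⁻¹ : ℝ) • x := by module
  simp only [schrodinger, smul_eq_mul, e1, inner_add_right, inner_smul_right, mul_assoc]
  congr 2
  rw [real_inner_comm x y, real_inner_comm y s]
  push_cast
  ring

/-- The symplectic Fourier transform of a matrix coefficient is again a matrix coefficient. -/
theorem symplFourier_matrixCoeff_neg {h : ℝ} (hh : 0 < h) (f g : 𝓢(Config ι, ℂ)) (p : Phase ι) :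
    symplFourier h (matrixCoeff h f g) (-p) = matrixCoeff h (fun t => f (-t)) g p := by
  obtain ⟨a, b⟩ := p
  -- Integration in `y` is Fourier inversion evaluated at the midpoint `s = a/2`; the dilation by
  -- `h` gives the constant.
  have hinv : ∀ x : Config ι, ∫ y, matrixCoeff h f g (x, y) *
      Complex.exp (Real.pi * Complex.I * h * (inner ℝ a y : ℝ)) =
      ((h ^ Fintype.card ι)⁻¹ : ℝ) *
        (f ((2⁻¹ : ℝ) • a - (2⁻¹ : ℝ) • x) * conj (g ((2⁻¹ : ℝ) • a + (2⁻¹ : ℝ) • x))) := by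
    intro x
    let K : Config ι → ℂ := fun s => f (s - (2⁻¹ : ℝ) • x) * conj (g (s + (2⁻¹ : ℝ) • x))
    have hKc : Continuous K := by
      have := f.continuous
      have := g.continuous
      fun_prop
    have hKi : Integrable K := by
      obtain ⟨C, hC, hg⟩ := g.exists_norm_le_one_add_norm_rpow 0
      refine (f.integrable.comp_sub_right ((2⁻¹ : ℝ) • x)).mul_bdd (c := C)
        (Continuous.aestronglyMeasurable (by have := g.continuous; fun_prop))
        (Filter.Eventually.of_forall fun s => ?_)
      rw [RCLike.norm_conj]
      simpa using hg (s + (2⁻¹ : ℝ) • x)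
    have hVK : ∀ y, matrixCoeff h f g (x, y) = 𝓕 K (h • y) := matrixCoeff_eq_fourier h f g x
    have hFi : Integrable (𝓕 K) := by
      let M : ℕ := Module.finrank ℝ (Config ι) + 1
      obtain ⟨C, hC, hB⟩ := exists_norm_matrixCoeff_le_snd h f g M
      have hi : Integrable (fun x : Config ι => (1 + ‖x‖) ^ (-(M : ℝ))) :=
        integrable_one_add_norm (by simp [M])
      refine (hi.const_mul C).mono' (Continuous.aestronglyMeasurable
        (VectorFourier.fourierIntegral_continuous Real.continuous_fourierChar
          continuous_inner hKi)) (Filter.Eventually.of_forall fun η => ?_)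
      have := hB (x, h⁻¹ • η)
      rwa [hVK, smul_inv_smul₀ hh.ne'] at this
    have h1 := congrFun (hKc.fourierInv_fourier_eq hKi hFi) ((2⁻¹ : ℝ) • a)
    rw [Real.fourierInv_eq'] at h1
    have h2 := Measure.integral_comp_smul (volume : Measure (Config ι))
      (fun η => Complex.exp ((2 * Real.pi * (inner ℝ η ((2⁻¹ : ℝ) • a) : ℝ) : ℝ) * Complex.I) •
        𝓕 K η) h
    rw [h1, finrank_euclideanSpace, abs_of_pos (by positivity), Complex.real_smul] at h2
    rw [← h2]
    refine integral_congr_ae (Filter.Eventually.of_forall fun y => ?_)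
    simp only [hVK, smul_eq_mul, inner_smul_left, inner_smul_right, real_inner_comm a y,
      conj_trivial]
    rw [mul_comm]
    congr 2
    push_cast
    ring
  have hint : Integrable (fun q : Phase ι => matrixCoeff h f g q *
      Complex.exp (Real.pi * Complex.I * h * symplForm (a, b) q)) := by
    refine (integrable_matrixCoeff hh f g).mul_bdd (c := 1) ?_
      (Filter.Eventually.of_forall fun q => (norm_cexp_pi_I _ _).le)
    refine Continuous.aestronglyMeasurable ?_
    have := (continuous_symplForm (ι := ι)).comp (f := fun q => ((a, b), q)) (by fun_prop)
    exact Complex.continuous_exp.comp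
      (continuous_const.mul (Complex.continuous_ofReal.comp this))
  simp only [symplFourier, symplForm_swap_neg]
  rw [Measure.volume_eq_prod, integral_prod _ hint]
  have hinner : ∀ x : Config ι, ∫ y, matrixCoeff h f g (x, y) *
      Complex.exp (Real.pi * Complex.I * h * symplForm (a, b) (x, y)) =
      ((h ^ Fintype.card ι)⁻¹ : ℝ) * (Complex.exp (-(Real.pi * Complex.I * h * (inner ℝ x b : ℝ))) *
        (f ((2⁻¹ : ℝ) • a - (2⁻¹ : ℝ) • x) * conj (g ((2⁻¹ : ℝ) • a + (2⁻¹ : ℝ) • x)))) := by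
    intro x
    rw [mul_left_comm, ← hinv x, ← integral_const_mul]
    refine integral_congr_ae (Filter.Eventually.of_forall fun y => ?_)
    simp only [symplForm]
    rw [mul_left_comm, ← Complex.exp_add]
    congr 2
    push_cast
    ring
  simp_rw [hinner]
  rw [integral_const_mul]
  -- The substitution `x = 2t - a` turns the arguments `(a ∓ x)/2` into `a - t` and `t`; its
  -- Jacobian `2^m` uses up the `1/2` in the normalization of the transform.
  have hcov := Measure.integral_comp_smul (volume : Measure (Config ι)) (fun x => Complex.exp
    (-(Real.pi * Complex.I * h * (inner ℝ (x - a) b : ℝ))) *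
        (f ((2⁻¹ : ℝ) • a - (2⁻¹ : ℝ) • (x - a)) * conj (g ((2⁻¹ : ℝ) • a + (2⁻¹ : ℝ) • (x - a))))) 2
  rw [integral_sub_right_eq_self (fun x => Complex.exp
    (-(Real.pi * Complex.I * h * (inner ℝ x b : ℝ))) *
        (f ((2⁻¹ : ℝ) • a - (2⁻¹ : ℝ) • x) * conj (g ((2⁻¹ : ℝ) • a + (2⁻¹ : ℝ) • x)))) a,
    finrank_euclideanSpace, abs_of_pos (by positivity), Complex.real_smul] at hcov
  rw [← mul_assoc, ← Complex.ofReal_mul]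
  have hconst : (h / 2) ^ Fintype.card ι * (h ^ Fintype.card ι)⁻¹ =
      ((2 : ℝ) ^ Fintype.card ι)⁻¹ := by
    rw [div_pow]
    field_simp
  rw [hconst, ← hcov]
  refine integral_congr_ae (Filter.Eventually.of_forall fun t => ?_)
  have e1 : (2⁻¹ : ℝ) • a - (2⁻¹ : ℝ) • ((2 : ℝ) • t - a) = -(t - a) := by module
  have e2 : (2⁻¹ : ℝ) • a + (2⁻¹ : ℝ) • ((2 : ℝ) • t - a) = t := by module
  simp only [schrodinger, e1, e2, mul_assoc]
  congr 2
  simp only [inner_sub_left, inner_smul_left, conj_trivial, real_inner_comm b t]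
  push_cast
  ring

end MatrixCoefficients

/-! ### The unitary `B` and its action on tensors with the squeezed Gaussian -/

section Unitary

variable {n : ℕ}

/-- The unitary transformation of `L²(ℝ^{2n})` onto `L²` of the phase space, as an integral
transform. -/
noncomputable def chirpTransform (h τ : ℝ) (f : DoubleConfig n → ℂ) : Phase (Fin n) → ℂ :=
  fun z => (((h ^ 2 / τ) ^ ((n : ℝ) / 2) : ℝ) : ℂ) *
    Complex.exp (-(Real.pi * Complex.I * h * (inner ℝ z.1 z.2 : ℝ))) *
    ∫ t, f t * Complex.exp (2 * Real.pi * Complex.I * h *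
      ((inner ℝ (z.1 - (halves t).1) (halves t).2 / τ + inner ℝ (halves t).1 z.2 : ℝ) : ℂ))

theorem norm_cexp_neg_pi_I (h s : ℝ) : ‖Complex.exp (-(Real.pi * Complex.I * h * s))‖ = 1 := by
  rw [cexp_pi_I_eq, ← neg_mul, ← Complex.ofReal_neg, Complex.norm_exp_ofReal_mul_I]

/-- The term `t₁·t₂/τ` of the phase does not involve `z` and is a chirp multiplier. The rest is
linear in `t`, so what remains is the Fourier transform at `(-ħ y, -ħ x/τ)`. The prefactor
`(ħ²/τ)^{n/2}` is the square root of the Jacobian of this substitution. -/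
theorem exists_unitary_eq_chirpTransform {h τ : ℝ} (hh : 0 < h) (hτ : 0 < τ) :
    ∃ B : L2 (DoubleConfig n) ≃ₗᵢ[ℂ] L2 (Phase (Fin n)),
      ∀ (f : DoubleConfig n → ℂ) (_ : Integrable f) (h2 : MemLp f 2),
        B (h2.toLp f) =ᵐ[volume] chirpTransform h τ f := by
  let χ : DoubleConfig n → ℂ := fun t => Complex.exp (-(Real.pi * Complex.I * h *
    ((2 * (inner ℝ (halves t).1 (halves t).2 / τ) : ℝ) : ℂ)))
  have hχc : Continuous χ := by
    have h1 := (continuous_halves (n := n)).fst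
    have h2 := (continuous_halves (n := n)).snd
    fun_prop
  have hχn : ∀ t, ‖χ t‖ = 1 := fun t => norm_cexp_neg_pi_I _ _
  obtain ⟨T₁, hT₁⟩ := exists_weightedComposition (μ := (volume : Measure (DoubleConfig n)))
    (ν := volume) (MeasurableEquiv.refl _) hχc.measurable one_pos hχn
    (by rw [inv_one, one_pow, ENNReal.ofReal_one, one_smul]; exact Measure.map_id)
  let c : ℝ := (h ^ 2 / τ) ^ ((n : ℝ) / 2)
  have hc : 0 < c := by positivity
  let m : Phase (Fin n) → ℂ := fun z => (c : ℂ) *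
    Complex.exp (-(Real.pi * Complex.I * h * (inner ℝ z.1 z.2 : ℝ)))
  have hmc : Continuous m := by fun_prop
  have hmn : ∀ z, ‖m z‖ = c := fun z => by
    rw [norm_mul, norm_cexp_neg_pi_I, Complex.norm_real, Real.norm_of_nonneg hc.le, mul_one]
  have hs : -h ≠ 0 := by simpa using hh.ne'
  have ht : -(h / τ) ≠ 0 := by simp [hh.ne', hτ.ne']
  let κ := (scaleSwap n (-h) (-(h / τ)) hs ht).trans (halvesEquiv n).symm
  have hhalves : MeasurePreserving (halvesEquiv n) := measurePreserving_halves
  have hκ : (volume : Measure (Phase (Fin n))).map κ = ENNReal.ofReal (c⁻¹ ^ 2) • volume := by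
    have : (κ : Phase (Fin n) → DoubleConfig n) =
        (halvesEquiv n).symm ∘ scaleSwap n (-h) (-(h / τ)) hs ht := rfl
    rw [this, ← Measure.map_map (halvesEquiv n).symm.measurable (MeasurableEquiv.measurable _),
      map_scaleSwap, Measure.map_smul, hhalves.symm.map_eq]
    congr 2
    have h1 : -h * -(h / τ) = h ^ 2 / τ := by ring
    rw [h1, abs_of_pos (by positivity), inv_pow, inv_pow, ← Real.rpow_natCast c,
      ← Real.rpow_mul (by positivity)]
    simp
  obtain ⟨T₂, hT₂⟩ := exists_weightedComposition κ hmc.measurable hc hmn hκ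
  refine ⟨T₁.trans ((Lp.fourierTransformₗᵢ (DoubleConfig n) ℂ).trans T₂), fun f h1 h2 => ?_⟩
  have hg1 : Integrable (fun t => χ t * f t) :=
    h1.bdd_mul (c := 1) hχc.aestronglyMeasurable (Filter.Eventually.of_forall fun t => (hχn t).le)
  have hg2 : MemLp (fun t => χ t * f t) 2 :=
    h2.of_le (hχc.aestronglyMeasurable.mul h2.1) (Filter.Eventually.of_forall fun t => by
      rw [norm_mul, hχn, one_mul])
  have e1 : T₁ (h2.toLp f) = hg2.toLp _ := by
    refine Lp.ext ((hT₁ _).trans (Filter.EventuallyEq.trans ?_ hg2.coeFn_toLp.symm))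
    filter_upwards [h2.coeFn_toLp] with t ht
    rw [MeasurableEquiv.refl_apply, ht]
  have hqmp : Measure.QuasiMeasurePreserving κ volume volume :=
    ⟨κ.measurable, by rw [hκ]; exact Measure.smul_absolutelyContinuous⟩
  simp only [LinearIsometryEquiv.trans_apply, e1]
  refine (hT₂ _).trans ?_
  filter_upwards [hqmp.ae (fourier_toLp_ae_eq hg1 hg2)] with z hz
  rw [hz, Real.fourier_eq']
  simp only [m, c, chirpTransform]
  congr 1
  refine integral_congr_ae (Filter.Eventually.of_forall fun t => ?_)
  have hκz : halves (κ z) = ((-h) • z.2, (-(h / τ)) • z.1) :=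
    (halvesEquiv n).apply_symm_apply _
  simp only [smul_eq_mul, χ]
  rw [← mul_assoc, ← Complex.exp_add, mul_comm, inner_eq_halves, hκz]
  congr 2
  simp only [inner_smul_right, inner_sub_left, real_inner_comm (halves t).2 z.1]
  push_cast
  ring

/-- Tensoring with a fixed unit vector is an isometry. -/
theorem exists_tensor_isometry {φ : Config (Fin n) → ℂ} (hφ : Measurable φ)
    (hφ1 : ∫⁻ t, ‖φ t‖ₑ ^ 2 = 1) :
    ∃ J : L2 (Config (Fin n)) →ₗᵢ[ℂ] L2 (DoubleConfig n),
      ∀ f, J f =ᵐ[volume] fun t => f (halves t).1 * φ (halves t).2 := by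
  have hfst : Measure.QuasiMeasurePreserving (fun t : DoubleConfig n => (halves t).1)
      volume volume :=
    Measure.quasiMeasurePreserving_fst.comp measurePreserving_halves.quasiMeasurePreserving
  have hsnd : Measurable (fun t : DoubleConfig n => (halves t).2) :=
    continuous_halves.snd.measurable
  have hnorm : ∀ f : L2 (Config (Fin n)),
      eLpNorm (fun t : DoubleConfig n => f (halves t).1 * φ (halves t).2) 2 volume =
        eLpNorm f 2 volume := by
    intro f
    refine ENNReal.pow_right_strictMono (n := 2) two_ne_zero |>.injective ?_
    rw [eLpNorm_two_sq, eLpNorm_two_sq]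
    simp only [enorm_mul, mul_pow]
    rw [measurePreserving_halves.lintegral_comp_emb (halvesEquiv n).measurableEmbedding
      (fun w : Config (Fin n) × Config (Fin n) => ‖f w.1‖ₑ ^ 2 * ‖φ w.2‖ₑ ^ 2),
      Measure.volume_eq_prod,
      lintegral_prod_mul (f := fun x => ‖f x‖ₑ ^ 2) (g := fun x => ‖φ x‖ₑ ^ 2)
        ((Lp.stronglyMeasurable f).measurable.enorm.pow_const 2).aemeasurable
        (hφ.enorm.pow_const 2).aemeasurable, hφ1, mul_one]
  have hmem : ∀ f : L2 (Config (Fin n)),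
      MemLp (fun t : DoubleConfig n => f (halves t).1 * φ (halves t).2) 2 := fun f =>
    ⟨((Lp.stronglyMeasurable f).measurable.comp hfst.measurable).mul (hφ.comp hsnd)
      |>.aestronglyMeasurable, by rw [hnorm]; exact Lp.eLpNorm_lt_top f⟩
  let J₀ : L2 (Config (Fin n)) →ₗ[ℂ] L2 (DoubleConfig n) :=
    { toFun := fun f => (hmem f).toLp _
      map_add' := fun f g => by
        rw [← MemLp.toLp_add]
        refine MemLp.toLp_congr _ _ ?_
        filter_upwards [hfst.ae (Lp.coeFn_add f g)] with t ht
        simp only [ht, Pi.add_apply, add_mul]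
      map_smul' := fun r f => by
        rw [RingHom.id_apply, ← MemLp.toLp_const_smul]
        refine MemLp.toLp_congr _ _ ?_
        filter_upwards [hfst.ae (Lp.coeFn_smul r f)] with t ht
        simp only [ht, Pi.smul_apply, smul_eq_mul, mul_assoc] }
  refine ⟨⟨J₀, fun f => ?_⟩, fun f => (hmem f).coeFn_toLp⟩
  change ‖(hmem f).toLp _‖ = _
  rw [Lp.norm_toLp, hnorm, Lp.norm_def]

theorem groundState_eq_ofReal (h τ : ℝ) (t : Config (Fin n)) : groundState h τ t =
    (((2 : ℝ) ^ ((n : ℝ) / 4) * Real.exp (-(Real.pi * h / τ) * ‖t‖ ^ 2) : ℝ) : ℂ) := by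
  rw [groundState, Fintype.card_fin]
  congr 3
  ring

theorem continuous_groundState (h τ : ℝ) :
    Continuous (groundState h τ : Config (Fin n) → ℂ) := by
  unfold groundState
  fun_prop

theorem norm_groundState_sq (h τ : ℝ) (t : Config (Fin n)) : ‖groundState h τ t‖ ^ 2 =
    (2 : ℝ) ^ ((n : ℝ) / 2) * Real.exp (-(2 * Real.pi * h / τ) * ‖t - 0‖ ^ 2) := by
  rw [groundState_eq_ofReal, Complex.norm_real, Real.norm_of_nonneg (by positivity), mul_pow,
    ← Real.rpow_natCast, ← Real.rpow_mul (by norm_num), ← Real.exp_nat_mul, sub_zero]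
  congr 2
  · push_cast; ring
  · push_cast; ring

variable {h τ : ℝ}

theorem integrable_groundState (hh : 0 < h) (hτ : 0 < τ) :
    Integrable (groundState h τ : Config (Fin n) → ℂ) := by
  have := integrable_shifted_gaussian (ι := Fin n) (α := Real.pi * h / τ) (by positivity) 0
  simp only [sub_zero] at this
  exact ((this.const_mul ((2 : ℝ) ^ ((n : ℝ) / 4))).ofReal).congr
    (Filter.Eventually.of_forall fun t => (groundState_eq_ofReal h τ t).symm)

theorem memLp_groundState (hh : 0 < h) (hτ : 0 < τ) :
    MemLp (groundState h τ : Config (Fin n) → ℂ) 2 := by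
  rw [memLp_two_iff_integrable_sq_norm (continuous_groundState h τ).aestronglyMeasurable]
  simp_rw [norm_groundState_sq]
  exact (integrable_shifted_gaussian (by positivity) 0).const_mul _

/-- With the given normalization the Gaussian is a unit vector only if `τ = ħ` (for `n > 0`), which
is why `unitGroundState` carries a further factor. -/
theorem lintegral_enorm_groundState_sq (hh : 0 < h) (hτ : 0 < τ) :
    ∫⁻ t : Config (Fin n), ‖groundState h τ t‖ₑ ^ 2 = ENNReal.ofReal ((τ / h) ^ ((n : ℝ) / 2)) := by
  have hi := (memLp_two_iff_integrable_sq_norm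
    (continuous_groundState (n := n) h τ).aestronglyMeasurable).1 (memLp_groundState hh hτ)
  have : ∀ t : Config (Fin n), ‖groundState h τ t‖ₑ ^ 2 =
      ENNReal.ofReal (‖groundState h τ t‖ ^ 2) := fun t => by
    rw [← ofReal_norm, ENNReal.ofReal_pow (norm_nonneg _)]
  simp_rw [this]
  rw [← ofReal_integral_eq_lintegral_ofReal hi
    (Filter.Eventually.of_forall fun t => by positivity)]
  simp_rw [norm_groundState_sq]
  rw [integral_const_mul, integral_shifted_gaussian (by positivity), Fintype.card_fin,
    ← Real.mul_rpow (by norm_num) (by positivity)]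
  congr 2
  field_simp

/-- The unit vector proportional to the squeezed Gaussian. -/
noncomputable def unitGroundState (h τ : ℝ) : Config (Fin n) → ℂ :=
  fun t => (((h / τ) ^ ((n : ℝ) / 4) : ℝ) : ℂ) * groundState h τ t

theorem continuous_unitGroundState (h τ : ℝ) :
    Continuous (unitGroundState h τ : Config (Fin n) → ℂ) :=
  continuous_const.mul (continuous_groundState h τ)

theorem lintegral_enorm_unitGroundState_sq (hh : 0 < h) (hτ : 0 < τ) :
    ∫⁻ t : Config (Fin n), ‖unitGroundState h τ t‖ₑ ^ 2 = 1 := by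
  simp only [unitGroundState, enorm_mul, mul_pow]
  rw [lintegral_const_mul' _ _ (by simp), lintegral_enorm_groundState_sq hh hτ, ← ofReal_norm,
    Complex.norm_real, Real.norm_of_nonneg (by positivity), ← ENNReal.ofReal_pow (by positivity),
    ← ENNReal.ofReal_mul (by positivity), ← Real.rpow_natCast, ← Real.rpow_mul (by positivity)]
  have : (n : ℝ) / 4 * (2 : ℕ) = n / 2 := by push_cast; ring
  rw [this, ← Real.mul_rpow (by positivity) (by positivity), div_mul_div_cancel₀ hτ.ne',
    div_self hh.ne', Real.one_rpow, ENNReal.ofReal_one]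

theorem fourierWigner_eq (h : ℝ) (f φ : Config (Fin n) → ℂ) (z : Phase (Fin n)) :
    fourierWigner h f φ z = Complex.exp (-(Real.pi * Complex.I * h * (inner ℝ z.1 z.2 : ℝ))) *
      ∫ t, f t * (Complex.exp (2 * Real.pi * Complex.I * h * (inner ℝ t z.2 : ℝ)) *
        conj (φ (t - z.1))) := by
  rw [fourierWigner, ← integral_const_mul]
  refine integral_congr_ae (Filter.Eventually.of_forall fun t => ?_)
  simp only [schrodinger, map_mul, ← Complex.exp_conj, Complex.conj_I, Complex.conj_ofReal]
  have : (Real.pi * -Complex.I * h * ((-2 * inner ℝ z.2 t + inner ℝ z.1 z.2 : ℝ) : ℂ)) =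
      -(Real.pi * Complex.I * h * (inner ℝ z.1 z.2 : ℝ) : ℂ) +
        2 * Real.pi * Complex.I * h * (inner ℝ t z.2 : ℝ) := by
    rw [real_inner_comm t z.2]
    push_cast
    ring
  rw [this, Complex.exp_add]
  ring

/-- The integral over the second half is the Fourier transform of the Gaussian at frequency
proportional to `x - t₁`. It reproduces `φ_τ(t₁ - x)`, which is the window of the covariant
transform. -/
theorem chirpTransform_tensor (hh : 0 < h) (hτ : 0 < τ) {f : Config (Fin n) → ℂ}
    (hf : Integrable f) (z : Phase (Fin n)) :
    chirpTransform h τ (fun t => f (halves t).1 * groundState h τ (halves t).2) z =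
      ((h ^ ((n : ℝ) / 2) : ℝ) : ℂ) * fourierWigner h f (groundState h τ) z := by
  let E : Config (Fin n) × Config (Fin n) → ℂ := fun w =>
    Complex.exp (2 * Real.pi * Complex.I * h *
      ((inner ℝ (z.1 - w.1) w.2 / τ + inner ℝ w.1 z.2 : ℝ) : ℂ))
  have hE : ∀ w, ‖E w‖ ≤ 1 := fun w => by
    have : (2 * Real.pi * Complex.I * h *
      ((inner ℝ (z.1 - w.1) w.2 / τ + inner ℝ w.1 z.2 : ℝ) : ℂ)) =
      Real.pi * Complex.I * h *
      ((2 * (inner ℝ (z.1 - w.1) w.2 / τ + inner ℝ w.1 z.2) : ℝ) : ℂ) := by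
      push_cast; ring
    simp only [E]
    rw [this, norm_cexp_pi_I]
  have hEc : Continuous E := by fun_prop
  have hint : Integrable (fun w : Config (Fin n) × Config (Fin n) =>
      f w.1 * groundState h τ w.2 * E w) :=
    (hf.mul_prod (integrable_groundState hh hτ)).mul_bdd (c := 1) hEc.aestronglyMeasurable
      (Filter.Eventually.of_forall hE)
  have hinner : ∀ t₁ : Config (Fin n), ∫ t₂, f t₁ * groundState h τ t₂ * E (t₁, t₂) =
      (((τ / h) ^ ((n : ℝ) / 2) : ℝ) : ℂ) * (f t₁ *
        (Complex.exp (2 * Real.pi * Complex.I * h * (inner ℝ t₁ z.2 : ℝ)) *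
        conj (groundState h τ (t₁ - z.1)))) := by
    intro t₁
    have hg := integral_shifted_gaussian_mul_cexp (ι := Fin n) (α := Real.pi * h / τ)
      (by positivity) (2 * Real.pi * h / τ) 0 (z.1 - t₁)
    have e1 : ∀ t₂, f t₁ * groundState h τ t₂ * E (t₁, t₂) =
        (f t₁ * (((2 : ℝ) ^ ((n : ℝ) / 4) : ℝ) : ℂ) *
          Complex.exp (2 * Real.pi * Complex.I * h * (inner ℝ t₁ z.2 : ℝ))) *
        ((Real.exp (-(Real.pi * h / τ) * ‖t₂ - 0‖ ^ 2) : ℂ) *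
        Complex.exp (Complex.I * (2 * Real.pi * h / τ : ℝ) * (inner ℝ (z.1 - t₁) t₂ : ℝ))) := by
      intro t₂
      have : E (t₁, t₂) = Complex.exp (2 * Real.pi * Complex.I * h * (inner ℝ t₁ z.2 : ℝ)) *
          Complex.exp (Complex.I * (2 * Real.pi * h / τ : ℝ) * (inner ℝ (z.1 - t₁) t₂ : ℝ)) := by
        simp only [E]
        rw [← Complex.exp_add]
        congr 1
        push_cast
        ring
      rw [this, groundState_eq_ofReal, sub_zero]
      push_cast
      ring
    simp_rw [e1]
    rw [integral_const_mul, hg, inner_zero_right, groundState_eq_ofReal, Complex.conj_ofReal,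
      Fintype.card_fin, norm_sub_rev z.1 t₁]
    have e2 : Real.pi / (Real.pi * h / τ) = τ / h := by field_simp
    have e3 : -((2 * Real.pi * h / τ) ^ 2 * ‖t₁ - z.1‖ ^ 2 / (4 * (Real.pi * h / τ))) =
        -(Real.pi * h / τ) * ‖t₁ - z.1‖ ^ 2 := by
      field_simp
      ring
    rw [e2, e3]
    push_cast
    simp only [mul_zero, Complex.exp_zero]
    ring
  have hconst : (h ^ 2 / τ) ^ ((n : ℝ) / 2) * (τ / h) ^ ((n : ℝ) / 2) = h ^ ((n : ℝ) / 2) := by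
    rw [← Real.mul_rpow (by positivity) (by positivity)]
    congr 1
    field_simp
  simp only [chirpTransform]
  rw [measurePreserving_halves.integral_comp (halvesEquiv n).measurableEmbedding
    (fun w => f w.1 * groundState h τ w.2 * E w), Measure.volume_eq_prod, integral_prod _ hint]
  simp_rw [hinner]
  rw [integral_const_mul, fourierWigner_eq, ← hconst]
  push_cast
  ring

theorem memLp_schrodinger (h : ℝ) {φ : Config (Fin n) → ℂ} (hφ : MemLp φ 2) (z : Phase (Fin n)) :
    MemLp (schrodinger h z φ) 2 := by
  have h1 : MemLp (fun t => φ (t - z.1)) 2 :=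
    hφ.comp_measurePreserving (measurePreserving_sub_right volume z.1)
  refine h1.of_le ?_ (Filter.Eventually.of_forall fun t => (norm_schrodinger h z φ t).le)
  refine AEStronglyMeasurable.mul (Continuous.aestronglyMeasurable ?_) h1.1
  fun_prop

/-- Shows that evaluation of the covariant transform at a point is continuous in `f`, and brings in
adjoints. -/
theorem fourierWigner_eq_inner (h : ℝ) {φ : Config (Fin n) → ℂ} (hφ : MemLp φ 2)
    (f : L2 (Config (Fin n))) (z : Phase (Fin n)) :
    fourierWigner h f φ z = inner ℂ ((memLp_schrodinger h hφ z).toLp _) f := by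
  rw [L2.inner_def, fourierWigner]
  refine integral_congr_ae ?_
  filter_upwards [(memLp_schrodinger h hφ z).coeFn_toLp] with t ht
  rw [ht, RCLike.inner_apply]

theorem fourierWigner_congr (h : ℝ) {f g φ : Config (Fin n) → ℂ} (he : f =ᵐ[volume] g) :
    fourierWigner h f φ = fourierWigner h g φ := by
  funext z
  exact integral_congr_ae (by filter_upwards [he] with t ht; rw [ht])

/-- A continuous linear map into `L²` that is given by a pointwise formula, continuous in the
argument at each point, on a dense subspace, is given by this formula everywhere. -/
theorem ae_eq_of_denseRange {X F S : Type*} [MeasurableSpace X] {μ : Measure X}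
    [NormedAddCommGroup F] [NormedSpace ℂ F] {d : S → F} (hd : DenseRange d)
    (T : F →L[ℂ] Lp ℂ 2 μ) (W : F → X → ℂ) (hW : ∀ x, Continuous fun f => W f x)
    (hTW : ∀ s, T (d s) =ᵐ[μ] W (d s)) (f : F) : T f =ᵐ[μ] W f := by
  obtain ⟨u, hu, hlim⟩ := mem_closure_iff_seq_limit.1 (hd f)
  choose s hs using hu
  have h1 : Filter.Tendsto (fun k => T (u k)) Filter.atTop (𝓝 (T f)) :=
    (T.continuous.tendsto f).comp hlim
  -- Convergence in `L²` gives convergence almost everywhere only along a subsequence, which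
  -- suffices to identify the limit.
  obtain ⟨φ, hφ, hae⟩ := (tendstoInMeasure_of_tendsto_Lp h1).exists_seq_tendsto_ae
  filter_upwards [hae, ae_all_iff.2 fun k => hTW (s k)] with x hx hk
  refine tendsto_nhds_unique hx ?_
  have h2 := ((hW x).tendsto f).comp (hlim.comp hφ.tendsto_atTop)
  refine h2.congr fun k => ?_
  simp only [Function.comp, ← hs, hk]

/-- The covariant transform with the squeezed Gaussian, expressed by the unitary transform. -/
theorem unitary_tensor_ae_eq (hh : 0 < h) (hτ : 0 < τ)
    (B : L2 (DoubleConfig n) ≃ₗᵢ[ℂ] L2 (Phase (Fin n)))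
    (hB : ∀ (f : DoubleConfig n → ℂ) (_ : Integrable f) (h2 : MemLp f 2),
        B (h2.toLp f) =ᵐ[volume] chirpTransform h τ f)
    (J : L2 (Config (Fin n)) →ₗᵢ[ℂ] L2 (DoubleConfig n))
    (hJ : ∀ f, J f =ᵐ[volume] fun t => f (halves t).1 * unitGroundState h τ (halves t).2)
    (f : L2 (Config (Fin n))) :
    B (J f) =ᵐ[volume] fun z => (((h / τ) ^ ((n : ℝ) / 4) * h ^ ((n : ℝ) / 2) : ℝ) : ℂ) *
      fourierWigner h f (groundState h τ) z := by
  -- The integral formula for `B` is known on `L¹ ∩ L²` only, so it is applied to Schwartz `f` and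
  -- extended by density.
  refine ae_eq_of_denseRange
    (SchwartzMap.denseRange_toLpCLM (E := Config (Fin n)) (F := ℂ) (p := 2) (μ := volume)
      ENNReal.ofNat_ne_top)
    ((B : L2 (DoubleConfig n) →L[ℂ] L2 (Phase (Fin n))) ∘L J.toContinuousLinearMap)
    (fun f z => (((h / τ) ^ ((n : ℝ) / 4) * h ^ ((n : ℝ) / 2) : ℝ) : ℂ) *
      fourierWigner h f (groundState h τ) z) (fun z => ?_) (fun s => ?_) f
  · simp_rw [fun f : L2 (Config (Fin n)) =>
      fourierWigner_eq_inner h (memLp_groundState (n := n) hh hτ) f z]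
    fun_prop
  · rw [SchwartzMap.toLpCLM_apply]
    have hs : (s.toLp 2 volume : L2 (Config (Fin n))) =ᵐ[volume] s := s.coeFn_toLp 2 volume
    have hfst : Measure.QuasiMeasurePreserving (fun t : DoubleConfig n => (halves t).1)
        volume volume :=
      Measure.quasiMeasurePreserving_fst.comp measurePreserving_halves.quasiMeasurePreserving
    let v : DoubleConfig n → ℂ := fun t => s (halves t).1 * unitGroundState h τ (halves t).2
    have hv : J (s.toLp 2 volume) =ᵐ[volume] v := by
      refine (hJ _).trans ?_
      filter_upwards [hfst.ae hs] with t ht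
      simp only [v, ht]
    have hv2 : MemLp v 2 := (Lp.memLp _).ae_eq hv
    have hJv : J (s.toLp 2 volume) = hv2.toLp v := Lp.ext (hv.trans hv2.coeFn_toLp.symm)
    have hv1 : Integrable v := by
      have h1 : Integrable (fun w : Config (Fin n) × Config (Fin n) =>
          s w.1 * unitGroundState h τ w.2) :=
        s.integrable.mul_prod ((integrable_groundState hh hτ).const_mul _)
      exact integrable_comp_halves h1
    have e1 : chirpTransform h τ v = fun z =>
        (((h / τ) ^ ((n : ℝ) / 4) * h ^ ((n : ℝ) / 2) : ℝ) : ℂ) *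
          fourierWigner h s (groundState h τ) z := by
      funext z
      have := chirpTransform_tensor hh hτ s.integrable z
      rw [Complex.ofReal_mul, mul_assoc, ← this]
      simp only [chirpTransform, v, unitGroundState, mul_left_comm (s _), mul_assoc
        ((((h / τ) ^ ((n : ℝ) / 4) : ℝ) : ℂ))]
      rw [integral_const_mul]
      ring
    rw [fourierWigner_congr h hs, ← e1]
    change B (J (s.toLp 2 volume)) =ᵐ[volume] _
    rw [hJv]
    exact hB v hv1 hv2

end Unitary

/-! ### The Fock–Segal–Bargmann space and its orthogonal projection -/

section Projection

variable {n : ℕ} {h τ : ℝ}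

/-- The composition of the unitary transform with the projection onto the multiples of the
squeezed Gaussian in the second variable, as an integral transform. -/
noncomputable def groundTransform (h τ : ℝ) (g : DoubleConfig n → ℂ) : Phase (Fin n) → ℂ :=
  fun z => (((h ^ 2 / τ) ^ ((n : ℝ) / 2) : ℝ) : ℂ) *
    ∫ t, g t * conj (schrodinger h z (groundState h τ) (halves t).1 *
      groundState h τ (halves t).2)

/-- The Fock--Segal--Bargmann space is the image of an isometry. -/
theorem fsbSpace_eq_range (hh : 0 < h) (hτ : 0 < τ)
    (V : L2 (Config (Fin n)) →ₗᵢ[ℂ] L2 (Phase (Fin n))) {c : ℂ} (hc : c ≠ 0)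
    (hV : ∀ f, V f =ᵐ[volume] fun z => c * fourierWigner h f (groundState h τ) z) :
    fsbSpace (Fin n) h τ = LinearMap.range V.toLinearMap := by
  have hset : {F : L2 (Phase (Fin n)) | ∃ f : L2 (Config (Fin n)),
      F =ᵐ[volume] fourierWigner h f (groundState h τ)} = LinearMap.range V.toLinearMap := by
    ext F
    constructor
    · rintro ⟨f, hf⟩
      refine ⟨c⁻¹ • f, Lp.ext ?_⟩
      have h1 : V (c⁻¹ • f) = c⁻¹ • V f := map_smul _ _ _
      change V (c⁻¹ • f) =ᵐ[volume] F
      rw [h1]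
      refine (Lp.coeFn_smul _ _).trans ?_
      filter_upwards [hf, hV f] with z hz hz'
      rw [Pi.smul_apply, hz', hz, smul_eq_mul, inv_mul_cancel_left₀ hc]
    · rintro ⟨f, rfl⟩
      refine ⟨c • f, ?_⟩
      refine (hV f).trans (Filter.Eventually.of_forall fun z => ?_)
      have hg := memLp_groundState (n := n) hh hτ
      simp only
      rw [fourierWigner_eq_inner h hg, fourierWigner_eq_inner h hg, inner_smul_right]
  -- The covariant transforms already form a subspace, closed as the range of an isometry; span and
  -- closure add nothing.
  rw [fsbSpace, hset, Submodule.span_eq, IsClosed.submodule_topologicalClosure_eq]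
  exact V.isometry.isClosedEmbedding.isClosed_range

/-- For the isometry `V = B J` the projection onto its range is `V V*`. Evaluating `V V* B g` at `z`
pairs `V* B g` with `ρ(z) φ_τ`, and moving `V*` across gives the pairing of `g` with `J (ρ(z) φ_τ)`.
-/
theorem orthogonalProjection_unitary_ae_eq (hh : 0 < h) (hτ : 0 < τ)
    (B : L2 (DoubleConfig n) ≃ₗᵢ[ℂ] L2 (Phase (Fin n)))
    (J : L2 (Config (Fin n)) →ₗᵢ[ℂ] L2 (DoubleConfig n))
    (hJ : ∀ f, J f =ᵐ[volume] fun t => f (halves t).1 * unitGroundState h τ (halves t).2)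
    (hBJ : ∀ f, B (J f) =ᵐ[volume] fun z =>
      (((h / τ) ^ ((n : ℝ) / 4) * h ^ ((n : ℝ) / 2) : ℝ) : ℂ) *
        fourierWigner h f (groundState h τ) z)
    (g : L2 (DoubleConfig n)) :
    ((fsbSpace (Fin n) h τ).starProjection (B g) : L2 (Phase (Fin n))) =ᵐ[volume]
      groundTransform h τ g := by
  let V : L2 (Config (Fin n)) →ₗᵢ[ℂ] L2 (Phase (Fin n)) := B.toLinearIsometry.comp J
  have hc : (((h / τ) ^ ((n : ℝ) / 4) * h ^ ((n : ℝ) / 2) : ℝ) : ℂ) ≠ 0 := by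
    rw [Complex.ofReal_ne_zero]; positivity
  have hrange := fsbSpace_eq_range hh hτ V hc hBJ
  let k : L2 (Config (Fin n)) := V.toContinuousLinearMap.adjoint (B g)
  have hP : (fsbSpace (Fin n) h τ).starProjection (B g) = V k := by
    refine Submodule.eq_starProjection_of_mem_of_inner_eq_zero ?_ ?_
    · rw [hrange]; exact ⟨k, rfl⟩
    · rw [hrange]
      rintro _ ⟨f, rfl⟩
      have h1 : inner ℂ (V k) (V f) = inner ℂ k f := V.inner_map_map k f
      have h2 : inner ℂ k f = inner ℂ (B g) (V f) :=
        ContinuousLinearMap.adjoint_inner_left V.toContinuousLinearMap f (B g)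
      change inner ℂ (B g - V k) (V f) = 0
      rw [inner_sub_left, h1, h2, sub_self]
  rw [hP]
  refine (hBJ k).trans (Filter.Eventually.of_forall fun z => ?_)
  have hg := memLp_groundState (n := n) hh hτ
  let r : L2 (Config (Fin n)) := (memLp_schrodinger h hg z).toLp _
  have h3 : inner ℂ r k = inner ℂ (J r) g := by
    have h4 : inner ℂ r k = inner ℂ (V r) (B g) :=
      ContinuousLinearMap.adjoint_inner_right V.toContinuousLinearMap r (B g)
    rw [h4]
    exact B.inner_map_map (J r) g
  simp only
  have hfst : Measure.QuasiMeasurePreserving (fun t : DoubleConfig n => (halves t).1)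
      volume volume :=
    Measure.quasiMeasurePreserving_fst.comp measurePreserving_halves.quasiMeasurePreserving
  have h5 : inner ℂ (J r) g = (((h / τ) ^ ((n : ℝ) / 4) : ℝ) : ℂ) *
      ∫ t, g t * conj (schrodinger h z (groundState h τ) (halves t).1 *
        groundState h τ (halves t).2) := by
    rw [L2.inner_def, ← integral_const_mul]
    refine integral_congr_ae ?_
    filter_upwards [hJ r, hfst.ae (memLp_schrodinger h hg z).coeFn_toLp] with t ht ht'
    simp only [ht, r, ht', RCLike.inner_apply, unitGroundState, map_mul, Complex.conj_ofReal]
    ring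
  rw [fourierWigner_eq_inner h hg, h3, h5, groundTransform, ← mul_assoc, ← Complex.ofReal_mul]
  congr 2
  have e1 : (h / τ) ^ ((n : ℝ) / 4) * (h / τ) ^ ((n : ℝ) / 4) = (h / τ) ^ ((n : ℝ) / 2) := by
    rw [← Real.rpow_add (by positivity)]
    congr 1
    ring
  rw [mul_right_comm, e1, ← Real.mul_rpow (by positivity) (by positivity)]
  congr 1
  ring

end Projection

/-! ### The Gaussian integral behind the Weyl symbol -/

section KernelIntegral

variable {n : ℕ} {h τ : ℝ}

/-- The factor `τ` on `b₂` equalizes the two widths: the kernel is a product of equal Gaussians in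
`b₁` and `b₂`, centred at `k` and `u/τ`. -/
theorem phaseGaussian_pair (hτ : 0 < τ) (u k b₁ b₂ : Config (Fin n)) :
    phaseGaussian h τ ((τ • b₂, (0 : Config (Fin n))) - (u, k - b₁)) =
      (Real.exp (-(Real.pi * h * τ / 2) * ‖b₂ - τ⁻¹ • u‖ ^ 2) : ℂ) *
        (Real.exp (-(Real.pi * h * τ / 2) * ‖b₁ - k‖ ^ 2) : ℂ) := by
  rw [phaseGaussian_eq_mul, Complex.ofReal_mul]
  have e1 : τ • b₂ - u = τ • (b₂ - τ⁻¹ • u) := by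
    rw [smul_sub, smul_inv_smul₀ hτ.ne']
  have e2 : (0 : Config (Fin n)) - (k - b₁) = b₁ - k := by abel
  simp only [Prod.fst_sub, Prod.snd_sub, e1, e2, norm_smul, mul_pow, Real.norm_eq_abs, sq_abs]
  congr 3
  field_simp

theorem integrable_leftAction_pair (hh : 0 < h) (hτ : 0 < τ) (z : Phase (Fin n))
    (a₁ a₂ : Config (Fin n)) :
    Integrable (fun w : Config (Fin n) × Config (Fin n) =>
      leftAction h ((2 : ℝ) • z - (a₁, w.1)) (phaseGaussian h τ) (τ • w.2, τ⁻¹ • a₂)) := by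
  have h1 := integrable_shifted_gaussian (ι := Fin n) (α := Real.pi * h * τ / 2) (by positivity)
    ((2 : ℝ) • z.2 - τ⁻¹ • a₂)
  have h2 := integrable_shifted_gaussian (ι := Fin n) (α := Real.pi * h * τ / 2) (by positivity)
    (τ⁻¹ • ((2 : ℝ) • z.1 - a₁))
  refine (h1.mul_prod h2).mono' ?_ (Filter.Eventually.of_forall fun w => ?_)
  · refine Continuous.aestronglyMeasurable ?_
    exact (continuous_leftAction_phaseGaussian (n := n) h τ).comp
      (f := fun w : Config (Fin n) × Config (Fin n) =>
        ((2 : ℝ) • z - (a₁, w.1), (τ • w.2, τ⁻¹ • a₂))) (by fun_prop)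
  · rw [norm_leftAction_phaseGaussian]
    have : ((τ • w.2, τ⁻¹ • a₂) : Phase (Fin n)) - ((2 : ℝ) • z - (a₁, w.1)) =
        (τ • w.2, (0 : Config (Fin n))) -
          ((2 : ℝ) • z.1 - a₁, ((2 : ℝ) • z.2 - τ⁻¹ • a₂) - w.1) := by
      ext1
      · simp
      · simp; abel
    rw [this, phaseGaussian_pair hτ, ← Complex.ofReal_mul, Complex.norm_real,
      Real.norm_of_nonneg (by positivity), mul_comm]

/-- The cross terms `P·Q` cancel. This separates the remaining variable `b₂` from `t₁` after the
integration in `b₁`. -/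
theorem gaussian_exponent_identity (hτ : 0 < τ) (P Q : Config (Fin n)) :
    -(Real.pi * h * τ / 2) * ‖P - τ⁻¹ • Q‖ ^ 2 +
      -(Real.pi * h / (2 * τ)) * ‖τ • P + Q‖ ^ 2 =
      -(Real.pi * h * τ) * ‖P‖ ^ 2 + -(Real.pi * h / τ) * ‖Q‖ ^ 2 := by
  rw [norm_sub_sq_real, norm_add_sq_real, inner_smul_left, inner_smul_right, norm_smul, norm_smul]
  simp only [conj_trivial, norm_inv, Real.norm_of_nonneg hτ.le]
  field_simp
  ring

/-- The partial Fourier integral of the kernel of the symbol map. -/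
theorem integral_leftAction_pair (hh : 0 < h) (hτ : 0 < τ) (z : Phase (Fin n))
    (s₁ s₂ t₁ t₂ : Config (Fin n)) :
    ∫ w : Config (Fin n) × Config (Fin n),
      leftAction h ((2 : ℝ) • z - (s₁ + t₁, w.1)) (phaseGaussian h τ)
          (τ • w.2, τ⁻¹ • (s₂ + t₂)) *
        Complex.exp (Real.pi * Complex.I * h *
          ((-2 * (inner ℝ w.1 t₁ + inner ℝ w.2 t₂) +
            (inner ℝ (s₁ + t₁) w.1 + inner ℝ (s₂ + t₂) w.2) : ℝ) : ℂ)) =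
      (((2 / (h * τ)) ^ ((n : ℝ) / 2) * (1 / (h * τ)) ^ ((n : ℝ) / 2) : ℝ) : ℂ) *
      (Complex.exp (2 * Real.pi * Complex.I * h *
        ((inner ℝ (z.1 - s₁) s₂ / τ + inner ℝ s₁ z.2 : ℝ) : ℂ)) *
      (Complex.exp (-(2 * Real.pi * Complex.I * h * (inner ℝ t₁ z.2 : ℝ))) *
        (Real.exp (-(Real.pi * h / τ) * (‖t₁ - z.1‖ ^ 2 + ‖t₂‖ ^ 2)) : ℂ))) := by
  obtain ⟨x, y⟩ := z
  set a₁ := s₁ + t₁ with ha₁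
  set a₂ := s₂ + t₂ with ha₂
  let u := (2 : ℝ) • x - a₁
  let k := (2 : ℝ) • y - τ⁻¹ • a₂
  have hα : 0 < Real.pi * h * τ / 2 := by positivity
  -- The total phase is sorted by `b₁`: it is linear there with frequency `τ b₂ + a₁ - 2 t₁`, so the
  -- `b₁` integral is the Fourier integral of a Gaussian centred at `k`.
  have hpt : ∀ b₁ b₂ : Config (Fin n),
      leftAction h ((2 : ℝ) • (x, y) - (a₁, b₁)) (phaseGaussian h τ) (τ • b₂, τ⁻¹ • a₂) *
        Complex.exp (Real.pi * Complex.I * h * ((-2 * (inner ℝ b₁ t₁ + inner ℝ b₂ t₂) +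
            (inner ℝ a₁ b₁ + inner ℝ a₂ b₂) : ℝ) : ℂ)) =
      (Complex.exp (Real.pi * Complex.I * h *
          ((inner ℝ u (τ⁻¹ • a₂) + inner ℝ b₂ (a₂ - (2 : ℝ) • t₂ - (2 * τ) • y) : ℝ) : ℂ)) *
        (Real.exp (-(Real.pi * h * τ / 2) * ‖b₂ - τ⁻¹ • u‖ ^ 2) : ℂ)) *
      ((Real.exp (-(Real.pi * h * τ / 2) * ‖b₁ - k‖ ^ 2) : ℂ) *
        Complex.exp (Complex.I * (Real.pi * h : ℝ) *
          (inner ℝ (τ • b₂ + a₁ - (2 : ℝ) • t₁) b₁ : ℝ))) := by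
    intro b₁ b₂
    have e1 : ((τ • b₂, τ⁻¹ • a₂) : Phase (Fin n)) - ((2 : ℝ) • (x, y) - (a₁, b₁)) =
        (τ • b₂, (0 : Config (Fin n))) - (u, k - b₁) := by
      ext1
      · simp [u]
      · simp [k]; abel
    rw [leftAction, e1, phaseGaussian_pair hτ]
    have e2 : (Real.pi * Complex.I * h *
          symplForm ((2 : ℝ) • (x, y) - (a₁, b₁)) (τ • b₂, τ⁻¹ • a₂) : ℂ) +
        Real.pi * Complex.I * h * ((-2 * (inner ℝ b₁ t₁ + inner ℝ b₂ t₂) +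
            (inner ℝ a₁ b₁ + inner ℝ a₂ b₂) : ℝ) : ℂ) =
        Real.pi * Complex.I * h *
          ((inner ℝ u (τ⁻¹ • a₂) + inner ℝ b₂ (a₂ - (2 : ℝ) • t₂ - (2 * τ) • y) : ℝ) : ℂ) +
        Complex.I * (Real.pi * h : ℝ) *
          (inner ℝ (τ • b₂ + a₁ - (2 : ℝ) • t₁) b₁ : ℝ) := by
      have : symplForm ((2 : ℝ) • (x, y) - (a₁, b₁)) (τ • b₂, τ⁻¹ • a₂) +
          (-2 * (inner ℝ b₁ t₁ + inner ℝ b₂ t₂) + (inner ℝ a₁ b₁ + inner ℝ a₂ b₂)) =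
          (inner ℝ u (τ⁻¹ • a₂) + inner ℝ b₂ (a₂ - (2 : ℝ) • t₂ - (2 * τ) • y)) +
            inner ℝ (τ • b₂ + a₁ - (2 : ℝ) • t₁) b₁ := by
        simp only [symplForm, Prod.fst_sub, Prod.snd_sub, Prod.smul_fst, Prod.smul_snd, u,
          inner_sub_left, inner_sub_right, inner_add_left, inner_smul_left, inner_smul_right,
          conj_trivial, real_inner_comm a₂ b₂, real_inner_comm b₁ t₁]
        ring
      rw [← mul_add, ← Complex.ofReal_add, this]
      push_cast
      ring
    calc _ = Complex.exp ((Real.pi * Complex.I * h *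
          symplForm ((2 : ℝ) • (x, y) - (a₁, b₁)) (τ • b₂, τ⁻¹ • a₂) : ℂ) +
        Real.pi * Complex.I * h * ((-2 * (inner ℝ b₁ t₁ + inner ℝ b₂ t₂) +
            (inner ℝ a₁ b₁ + inner ℝ a₂ b₂) : ℝ) : ℂ)) *
          ((Real.exp (-(Real.pi * h * τ / 2) * ‖b₂ - τ⁻¹ • u‖ ^ 2) : ℂ) *
        (Real.exp (-(Real.pi * h * τ / 2) * ‖b₁ - k‖ ^ 2) : ℂ)) := by
          rw [Complex.exp_add]; ring
      _ = _ := by rw [e2, Complex.exp_add]; ring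
  have hint : Integrable (fun w : Config (Fin n) × Config (Fin n) =>
      leftAction h ((2 : ℝ) • (x, y) - (a₁, w.1)) (phaseGaussian h τ) (τ • w.2, τ⁻¹ • a₂) *
        Complex.exp (Real.pi * Complex.I * h * ((-2 * (inner ℝ w.1 t₁ + inner ℝ w.2 t₂) +
            (inner ℝ a₁ w.1 + inner ℝ a₂ w.2) : ℝ) : ℂ))) :=
    (integrable_leftAction_pair hh hτ (x, y) a₁ a₂).mul_bdd (c := 1)
      (Continuous.aestronglyMeasurable (by fun_prop))
      (Filter.Eventually.of_forall fun w => (norm_cexp_pi_I _ _).le)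
  rw [Measure.volume_eq_prod, integral_prod_symm _ hint]
  simp_rw [hpt, integral_const_mul]
  simp_rw [integral_shifted_gaussian_mul_cexp hα, Fintype.card_fin]
  -- The centre of the Gaussian in `b₂` once the Gaussian produced by the `b₁` integral is merged
  -- with the original one.
  let k₂ := τ⁻¹ • (x - s₁)
  have hα₂ : 0 < Real.pi * h * τ := by positivity
  have hpt2 : ∀ b₂ : Config (Fin n),
      (Complex.exp (Real.pi * Complex.I * h *
          ((inner ℝ u (τ⁻¹ • a₂) + inner ℝ b₂ (a₂ - (2 : ℝ) • t₂ - (2 * τ) • y) : ℝ) : ℂ)) *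
        (Real.exp (-(Real.pi * h * τ / 2) * ‖b₂ - τ⁻¹ • u‖ ^ 2) : ℂ)) *
      ((((Real.pi / (Real.pi * h * τ / 2)) ^ ((n : ℝ) / 2) : ℝ) : ℂ) *
        (Real.exp (-((Real.pi * h) ^ 2 * ‖τ • b₂ + a₁ - (2 : ℝ) • t₁‖ ^ 2 /
          (4 * (Real.pi * h * τ / 2)))) : ℂ) *
        Complex.exp (Complex.I * (Real.pi * h : ℝ) *
          (inner ℝ (τ • b₂ + a₁ - (2 : ℝ) • t₁) k : ℝ))) =
      ((((2 / (h * τ)) ^ ((n : ℝ) / 2) : ℝ) : ℂ) *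
        Complex.exp (Real.pi * Complex.I * h *
          ((inner ℝ u (τ⁻¹ • a₂) + inner ℝ (a₁ - (2 : ℝ) • t₁) k : ℝ) : ℂ)) *
        (Real.exp (-(Real.pi * h / τ) * ‖x - t₁‖ ^ 2) : ℂ)) *
      ((Real.exp (-(Real.pi * h * τ) * ‖b₂ - k₂‖ ^ 2) : ℂ) *
        Complex.exp (Complex.I * (-(2 * Real.pi * h) : ℝ) * (inner ℝ t₂ b₂ : ℝ))) := by
    intro b₂
    have e1 : b₂ - τ⁻¹ • u = (b₂ - k₂) - τ⁻¹ • (x - t₁) := by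
      simp only [u, k₂, ha₁]; module
    have e2 : τ • b₂ + a₁ - (2 : ℝ) • t₁ = τ • (b₂ - k₂) + (x - t₁) := by
      simp only [k₂, ha₁, smul_sub, smul_inv_smul₀ hτ.ne']; module
    have e3 : Real.pi / (Real.pi * h * τ / 2) = 2 / (h * τ) := by field_simp
    have e4 : -((Real.pi * h) ^ 2 * ‖τ • (b₂ - k₂) + (x - t₁)‖ ^ 2 /
        (4 * (Real.pi * h * τ / 2))) =
        -(Real.pi * h / (2 * τ)) * ‖τ • (b₂ - k₂) + (x - t₁)‖ ^ 2 := by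
      field_simp
      norm_num
    have e5 := gaussian_exponent_identity (h := h) hτ (b₂ - k₂) (x - t₁)
    have e6 : (Real.exp (-(Real.pi * h * τ / 2) * ‖b₂ - τ⁻¹ • u‖ ^ 2) : ℂ) *
        (Real.exp (-((Real.pi * h) ^ 2 * ‖τ • b₂ + a₁ - (2 : ℝ) • t₁‖ ^ 2 /
          (4 * (Real.pi * h * τ / 2)))) : ℂ) =
        (Real.exp (-(Real.pi * h * τ) * ‖b₂ - k₂‖ ^ 2) : ℂ) *
        (Real.exp (-(Real.pi * h / τ) * ‖x - t₁‖ ^ 2) : ℂ) := by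
      rw [← Complex.ofReal_mul, ← Complex.ofReal_mul, ← Real.exp_add, ← Real.exp_add, e1, e2, e4, e5]
    -- The centre `k = 2y - a₂/τ` cancels the pairings of `b₂` with `a₂` and `y`, leaving the
    -- frequency `-2 t₂`.
    have e7 : Complex.exp (Real.pi * Complex.I * h *
          ((inner ℝ u (τ⁻¹ • a₂) + inner ℝ b₂ (a₂ - (2 : ℝ) • t₂ - (2 * τ) • y) : ℝ) : ℂ)) *
        Complex.exp (Complex.I * (Real.pi * h : ℝ) *
          (inner ℝ (τ • b₂ + a₁ - (2 : ℝ) • t₁) k : ℝ)) =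
        Complex.exp (Real.pi * Complex.I * h *
          ((inner ℝ u (τ⁻¹ • a₂) + inner ℝ (a₁ - (2 : ℝ) • t₁) k : ℝ) : ℂ)) *
        Complex.exp (Complex.I * (-(2 * Real.pi * h) : ℝ) * (inner ℝ t₂ b₂ : ℝ)) := by
      have : inner ℝ b₂ (a₂ - (2 : ℝ) • t₂ - (2 * τ) • y) +
          inner ℝ (τ • b₂ + a₁ - (2 : ℝ) • t₁) k =
          inner ℝ (a₁ - (2 : ℝ) • t₁) k - 2 * inner ℝ t₂ b₂ := by
        simp only [k, inner_sub_left, inner_sub_right, inner_add_left, inner_smul_left,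
          inner_smul_right, conj_trivial, real_inner_comm b₂ t₂]
        field_simp
        ring
      have h' := congrArg (fun r : ℝ => (r : ℂ)) this
      push_cast at h'
      rw [← Complex.exp_add, ← Complex.exp_add]
      congr 1
      push_cast
      linear_combination (Real.pi * Complex.I * h : ℂ) * h'
    rw [e3]
    linear_combination ((((2 / (h * τ)) ^ ((n : ℝ) / 2) : ℝ) : ℂ)) *
      (Complex.exp (Real.pi * Complex.I * h *
          ((inner ℝ u (τ⁻¹ • a₂) + inner ℝ b₂ (a₂ - (2 : ℝ) • t₂ - (2 * τ) • y) : ℝ) : ℂ)) *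
        Complex.exp (Complex.I * (Real.pi * h : ℝ) *
          (inner ℝ (τ • b₂ + a₁ - (2 : ℝ) • t₁) k : ℝ))) * e6 +
      ((((2 / (h * τ)) ^ ((n : ℝ) / 2) : ℝ) : ℂ)) *
      ((Real.exp (-(Real.pi * h * τ) * ‖b₂ - k₂‖ ^ 2) : ℂ) *
        (Real.exp (-(Real.pi * h / τ) * ‖x - t₁‖ ^ 2) : ℂ)) * e7
  simp_rw [hpt2, integral_const_mul]
  rw [integral_shifted_gaussian_mul_cexp hα₂, Fintype.card_fin]
  have e3 : Real.pi / (Real.pi * h * τ) = 1 / (h * τ) := by field_simp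
  have e4 : -((-(2 * Real.pi * h)) ^ 2 * ‖t₂‖ ^ 2 / (4 * (Real.pi * h * τ))) =
      -(Real.pi * h / τ) * ‖t₂‖ ^ 2 := by
    field_simp
    ring
  have e6 : (Real.exp (-(Real.pi * h / τ) * (‖t₁ - x‖ ^ 2 + ‖t₂‖ ^ 2)) : ℂ) =
      (Real.exp (-(Real.pi * h / τ) * ‖x - t₁‖ ^ 2) : ℂ) *
        (Real.exp (-(Real.pi * h / τ) * ‖t₂‖ ^ 2) : ℂ) := by
    rw [← Complex.ofReal_mul, ← Real.exp_add, norm_sub_rev, mul_add]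
  have e7 : Complex.exp (Real.pi * Complex.I * h *
          ((inner ℝ u (τ⁻¹ • a₂) + inner ℝ (a₁ - (2 : ℝ) • t₁) k : ℝ) : ℂ)) *
      Complex.exp (Complex.I * (-(2 * Real.pi * h) : ℝ) * (inner ℝ t₂ k₂ : ℝ)) =
      Complex.exp (2 * Real.pi * Complex.I * h *
        ((inner ℝ (x - s₁) s₂ / τ + inner ℝ s₁ y : ℝ) : ℂ)) *
      Complex.exp (-(2 * Real.pi * Complex.I * h * (inner ℝ t₁ y : ℝ))) := by
    have : inner ℝ u (τ⁻¹ • a₂) + inner ℝ (a₁ - (2 : ℝ) • t₁) k - 2 * inner ℝ t₂ k₂ =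
        2 * (inner ℝ (x - s₁) s₂ / τ + inner ℝ s₁ y) - 2 * inner ℝ t₁ y := by
      simp only [u, k, k₂, ha₁, ha₂, inner_sub_left, inner_sub_right, inner_add_left,
        inner_add_right, inner_smul_left, inner_smul_right, conj_trivial, real_inner_comm x t₂,
        real_inner_comm s₁ t₂]
      field_simp
      ring
    have h' := congrArg (fun r : ℝ => (r : ℂ)) this
    push_cast at h'
    rw [← Complex.exp_add, ← Complex.exp_add]
    congr 1
    push_cast
    linear_combination (Real.pi * Complex.I * h : ℂ) * h'
  rw [e3, e4, e6, Complex.ofReal_mul]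
  linear_combination ((((2 / (h * τ)) ^ ((n : ℝ) / 2) : ℝ) : ℂ)) *
    ((((1 / (h * τ)) ^ ((n : ℝ) / 2) : ℝ) : ℂ)) *
    ((Real.exp (-(Real.pi * h / τ) * ‖x - t₁‖ ^ 2) : ℂ) *
        (Real.exp (-(Real.pi * h / τ) * ‖t₂‖ ^ 2) : ℂ)) * e7

end KernelIntegral

/-! ### Pairing the symbol with matrix coefficients; the Weyl operators -/

section WeylPairing

variable {n : ℕ} {h τ : ℝ}

theorem halves_add (s t : DoubleConfig n) : halves (s + t) = halves s + halves t :=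
  map_add (EuclideanSpace.sumEquivProd (𝕜 := ℝ) (ι := Fin n) (κ := Fin n)) s t

theorem integral_leftAction_double (hh : 0 < h) (hτ : 0 < τ) (z : Phase (Fin n))
    (s t : DoubleConfig n) :
    ∫ b : DoubleConfig n,
      leftAction h ((2 : ℝ) • z - firstPair (s + t, b)) (phaseGaussian h τ)
          (secondPair τ (s + t, b)) *
        Complex.exp (Real.pi * Complex.I * h * ((-2 * inner ℝ b t + inner ℝ (s + t) b : ℝ) : ℂ)) =
      (((2 / (h * τ)) ^ ((n : ℝ) / 2) * (1 / (h * τ)) ^ ((n : ℝ) / 2) : ℝ) : ℂ) *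
      (Complex.exp (2 * Real.pi * Complex.I * h *
        ((inner ℝ (z.1 - (halves s).1) (halves s).2 / τ + inner ℝ (halves s).1 z.2 : ℝ) : ℂ)) *
      (Complex.exp (-(2 * Real.pi * Complex.I * h * (inner ℝ (halves t).1 z.2 : ℝ))) *
        (Real.exp (-(Real.pi * h / τ) * (‖(halves t).1 - z.1‖ ^ 2 + ‖(halves t).2‖ ^ 2)) : ℂ))) := by
  rw [← integral_leftAction_pair hh hτ z, ← measurePreserving_halves.integral_comp
    (halvesEquiv n).measurableEmbedding]
  refine integral_congr_ae (Filter.Eventually.of_forall fun b => ?_)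
  simp only [firstPair, secondPair, inner_eq_halves, halves_add, Prod.fst_add, Prod.snd_add]

theorem integrable_leftAction_double (hh : 0 < h) (hτ : 0 < τ) (z : Phase (Fin n))
    (a : DoubleConfig n) :
    Integrable fun b : DoubleConfig n =>
      leftAction h ((2 : ℝ) • z - firstPair (a, b)) (phaseGaussian h τ) (secondPair τ (a, b)) :=
  integrable_comp_halves (integrable_leftAction_pair hh hτ z (halves a).1 (halves a).2)

theorem continuous_symbol_kernel (h τ : ℝ) :
    Continuous fun w : Phase (Fin n) × Phase (Fin n ⊕ Fin n) =>
      leftAction h ((2 : ℝ) • w.1 - firstPair w.2) (phaseGaussian h τ) (secondPair τ w.2) := by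
  have hc := (continuous_pairs (n := n) τ).comp
    (continuous_snd (X := Phase (Fin n)) (Y := Phase (Fin n ⊕ Fin n)))
  exact (continuous_leftAction_phaseGaussian (n := n) h τ).comp
    (f := fun w : Phase (Fin n) × Phase (Fin n ⊕ Fin n) =>
      ((2 : ℝ) • w.1 - firstPair w.2, secondPair τ w.2))
      (((continuous_fst.const_smul (2 : ℝ)).sub hc.fst).prodMk hc.snd)

theorem norm_symbol_kernel_le_one (hh : 0 < h) (hτ : 0 < τ) (p q : Phase (Fin n)) :
    ‖leftAction h p (phaseGaussian h τ) q‖ ≤ 1 := by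
  rw [norm_leftAction_phaseGaussian]
  exact norm_phaseGaussian_le_one hh hτ _

/-- The phase factor in the unitary transform. -/
noncomputable def chirpFactor (h τ : ℝ) (z : Phase (Fin n)) (s : DoubleConfig n) : ℂ :=
  Complex.exp (2 * Real.pi * Complex.I * h *
    ((inner ℝ (z.1 - (halves s).1) (halves s).2 / τ + inner ℝ (halves s).1 z.2 : ℝ) : ℂ))

/-- The Gaussian factor in the transform of the projection. -/
noncomputable def groundFactor (h τ : ℝ) (z : Phase (Fin n)) (t : DoubleConfig n) : ℂ :=
  Complex.exp (-(2 * Real.pi * Complex.I * h * (inner ℝ (halves t).1 z.2 : ℝ))) *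
    (Real.exp (-(Real.pi * h / τ) * (‖(halves t).1 - z.1‖ ^ 2 + ‖(halves t).2‖ ^ 2)) : ℂ)

theorem continuous_chirpFactor (h τ : ℝ) (z : Phase (Fin n)) : Continuous (chirpFactor h τ z) := by
  have h1 := (continuous_halves (n := n)).fst
  have h2 := (continuous_halves (n := n)).snd
  unfold chirpFactor
  fun_prop

theorem continuous_groundFactor (h τ : ℝ) (z : Phase (Fin n)) :
    Continuous (groundFactor h τ z) := by
  have h1 := (continuous_halves (n := n)).fst
  have h2 := (continuous_halves (n := n)).snd
  unfold groundFactor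
  fun_prop

theorem norm_chirpFactor (h τ : ℝ) (z : Phase (Fin n)) (s : DoubleConfig n) :
    ‖chirpFactor h τ z s‖ = 1 := by
  rw [chirpFactor, show ∀ r : ℝ, (2 * Real.pi * Complex.I * h * r : ℂ) =
    Real.pi * Complex.I * h * (2 * r : ℝ) from fun r => by push_cast; ring, norm_cexp_pi_I]

theorem norm_groundFactor_le_one (hh : 0 < h) (hτ : 0 < τ) (z : Phase (Fin n))
    (t : DoubleConfig n) : ‖groundFactor h τ z t‖ ≤ 1 := by
  rw [groundFactor, norm_mul, show ∀ r : ℝ, (-(2 * Real.pi * Complex.I * h * r) : ℂ) =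
    -(Real.pi * Complex.I * h * (2 * r : ℝ)) from fun r => by push_cast; ring,
    norm_cexp_neg_pi_I, one_mul, Complex.norm_real, Real.norm_eq_abs, Real.abs_exp,
    Real.exp_le_one_iff, neg_mul, neg_nonpos]
  positivity

/-- Exhibits the phase `exp(πiħ x·y)`, which later cancels the one in `chirpTransform`; the factor
`2^{n/2}` collects the two normalizations `2^{n/4}`. -/
theorem groundTransform_conj (h τ : ℝ) (g : DoubleConfig n → ℂ)
    (z : Phase (Fin n)) :
    conj (groundTransform h τ g z) =
      (((h ^ 2 / τ) ^ ((n : ℝ) / 2) * 2 ^ ((n : ℝ) / 2) : ℝ) : ℂ) *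
        Complex.exp (Real.pi * Complex.I * h * (inner ℝ z.1 z.2 : ℝ)) *
        ∫ t, conj (g t) * groundFactor h τ z t := by
  rw [groundTransform, map_mul, Complex.conj_ofReal, ← integral_conj, Complex.ofReal_mul,
    mul_assoc, mul_assoc]
  congr 1
  rw [← mul_assoc, ← integral_const_mul]
  refine integral_congr_ae (Filter.Eventually.of_forall fun t => ?_)
  simp only [map_mul, Complex.conj_conj, schrodinger, groundFactor, groundState_eq_ofReal]
  have e1 : (2 : ℝ) ^ ((n : ℝ) / 2) = 2 ^ ((n : ℝ) / 4) * 2 ^ ((n : ℝ) / 4) := by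
    rw [← Real.rpow_add (by norm_num)]
    congr 1
    ring
  have e2 : (Real.pi * Complex.I * h *
      ((-2 * inner ℝ z.2 (halves t).1 + inner ℝ z.1 z.2 : ℝ) : ℂ)) =
      Real.pi * Complex.I * h * (inner ℝ z.1 z.2 : ℝ) +
        -(2 * Real.pi * Complex.I * h * (inner ℝ (halves t).1 z.2 : ℝ)) := by
    rw [real_inner_comm (halves t).1 z.2]
    push_cast
    ring
  rw [e1, e2, Complex.exp_add, mul_add, Real.exp_add]
  push_cast
  ring

/-- The partial integral of the product of the kernel of the symbol map and a matrix coefficient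
is a convolution. -/
theorem integral_symbol_kernel_mul_matrixCoeff_slice (hh : 0 < h) (hτ : 0 < τ)
    (f g : 𝓢(DoubleConfig n, ℂ)) (z : Phase (Fin n)) (a : DoubleConfig n) :
    ∫ b, leftAction h ((2 : ℝ) • z - firstPair (a, b)) (phaseGaussian h τ) (secondPair τ (a, b)) *
        matrixCoeff h (fun t => f (-t)) g (a, b) =
      (((2 / (h * τ)) ^ ((n : ℝ) / 2) * (1 / (h * τ)) ^ ((n : ℝ) / 2) : ℝ) : ℂ) *
        ∫ t, (conj (g t) * groundFactor h τ z t) * (f (a - t) * chirpFactor h τ z (a - t)) := by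
  have hLi := integrable_leftAction_double hh hτ z a
  have hfg : Integrable (fun t => f (a - t) * conj (g t)) := by
    obtain ⟨C, hC, hf⟩ := f.exists_norm_le_one_add_norm_rpow 0
    refine ((Complex.conjCLE.integrable_comp_iff).2 g.integrable).bdd_mul (c := C)
      (Continuous.aestronglyMeasurable (by have := f.continuous; fun_prop))
      (Filter.Eventually.of_forall fun t => ?_)
    simpa using hf (a - t)
  let G : DoubleConfig n → DoubleConfig n → ℂ := fun b t =>
    leftAction h ((2 : ℝ) • z - firstPair (a, b)) (phaseGaussian h τ) (secondPair τ (a, b)) *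
      (f (a - t) * conj (g t)) * Complex.exp (Real.pi * Complex.I * h *
        ((-2 * inner ℝ b t + inner ℝ a b : ℝ) : ℂ))
  have hprod : Integrable (fun w : DoubleConfig n × DoubleConfig n => G w.1 w.2)
      (volume.prod volume) :=
    (hLi.mul_prod hfg).mul_bdd (c := 1)
      (Continuous.aestronglyMeasurable (by fun_prop))
      (Filter.Eventually.of_forall fun w => (norm_cexp_pi_I _ _).le)
  have h1 : ∀ b, leftAction h ((2 : ℝ) • z - firstPair (a, b)) (phaseGaussian h τ)
      (secondPair τ (a, b)) * matrixCoeff h (fun t => f (-t)) g (a, b) = ∫ t, G b t := by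
    intro b
    simp only [matrixCoeff]
    rw [← integral_const_mul]
    refine integral_congr_ae (Filter.Eventually.of_forall fun t => ?_)
    simp only [schrodinger, neg_sub, G]
    ring
  have h2 : ∀ t, ∫ b, G b t =
      (((2 / (h * τ)) ^ ((n : ℝ) / 2) * (1 / (h * τ)) ^ ((n : ℝ) / 2) : ℝ) : ℂ) *
        ((conj (g t) * groundFactor h τ z t) * (f (a - t) * chirpFactor h τ z (a - t))) := by
    intro t
    -- The Gaussian integral is applied with `s = a - t`; its factors in `s` and `t` then form the
    -- integrand of a convolution.
    have e1 := integral_leftAction_double hh hτ z (a - t) t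
    rw [sub_add_cancel] at e1
    simp only [G, mul_right_comm (leftAction h _ _ _) (f (a - t) * conj (g t))]
    rw [integral_mul_const, e1, chirpFactor, groundFactor]
    ring
  simp_rw [h1]
  rw [integral_integral_swap (f := G) hprod]
  simp_rw [h2]
  rw [integral_const_mul]

/-- Fixes the power `ħ^{3n}` in the symbol: both sides are `(2ħ⁴/τ²)^{n/2}`. -/
theorem symbol_pairing_const (hh : 0 < h) (hτ : 0 < τ) :
    h ^ (3 * n) * ((2 / (h * τ)) ^ ((n : ℝ) / 2) * (1 / (h * τ)) ^ ((n : ℝ) / 2)) =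
      (h ^ 2 / τ) ^ ((n : ℝ) / 2) * ((h ^ 2 / τ) ^ ((n : ℝ) / 2) * 2 ^ ((n : ℝ) / 2)) := by
  have e1 : h ^ (3 * n) = (h ^ 6) ^ ((n : ℝ) / 2) := by
    rw [← Real.rpow_natCast, ← Real.rpow_natCast, ← Real.rpow_mul hh.le]
    congr 1
    push_cast
    ring
  rw [e1, ← Real.mul_rpow (by positivity) (by positivity),
    ← Real.mul_rpow (by positivity) (by positivity),
    ← Real.mul_rpow (by positivity) (by positivity),
    ← Real.mul_rpow (by positivity) (by positivity)]
  congr 1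
  field_simp

/-- The pairing of the kernel of the symbol map with a matrix coefficient factorizes. -/
theorem integral_symbol_kernel_mul_matrixCoeff (hh : 0 < h) (hτ : 0 < τ)
    (f g : 𝓢(DoubleConfig n, ℂ)) (hM : Integrable (matrixCoeff h (fun t => f (-t)) g))
    (z : Phase (Fin n)) :
    ((h ^ (3 * n) : ℝ) : ℂ) * ∫ p : Phase (Fin n ⊕ Fin n),
      leftAction h ((2 : ℝ) • z - firstPair p) (phaseGaussian h τ) (secondPair τ p) *
        matrixCoeff h (fun t => f (-t)) g p =
      chirpTransform h τ f z * conj (groundTransform h τ g z) := by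
  have hLc : Continuous fun p : Phase (Fin n ⊕ Fin n) =>
      leftAction h ((2 : ℝ) • z - firstPair p) (phaseGaussian h τ) (secondPair τ p) :=
    Continuous.comp' (g := fun w : Phase (Fin n) × Phase (Fin n ⊕ Fin n) =>
      leftAction h ((2 : ℝ) • w.1 - firstPair w.2) (phaseGaussian h τ) (secondPair τ w.2))
      (f := fun p => (z, p)) (continuous_symbol_kernel h τ) (Continuous.prodMk_right z)
  have hb : ∀ p : Phase (Fin n ⊕ Fin n), ‖leftAction h ((2 : ℝ) • z - firstPair p)
      (phaseGaussian h τ) (secondPair τ p)‖ ≤ 1 := fun p =>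
    norm_symbol_kernel_le_one hh hτ ((2 : ℝ) • z - firstPair p) (secondPair τ p)
  have hint : Integrable (fun p : Phase (Fin n ⊕ Fin n) =>
      leftAction h ((2 : ℝ) • z - firstPair p) (phaseGaussian h τ) (secondPair τ p) *
        matrixCoeff h (fun t => f (-t)) g p) :=
    hM.bdd_mul (c := 1) hLc.aestronglyMeasurable (Filter.Eventually.of_forall hb)
  have hu : Integrable (fun s => f s * chirpFactor h τ z s) := f.integrable.mul_bdd (c := 1)
    (continuous_chirpFactor h τ z).aestronglyMeasurable
    (Filter.Eventually.of_forall fun s => (norm_chirpFactor h τ z s).le)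
  have hv : Integrable (fun t => conj (g t) * groundFactor h τ z t) := Integrable.mul_bdd (c := 1)
    ((Complex.conjCLE.integrable_comp_iff).2 g.integrable)
    (continuous_groundFactor h τ z).aestronglyMeasurable
    (Filter.Eventually.of_forall fun t => norm_groundFactor_le_one hh hτ z t)
  -- The integral of a convolution is the product of the integrals; this is where the pairing
  -- becomes rank one in `(f, g)`.
  have hconv : ∫ a, ∫ t, (conj (g t) * groundFactor h τ z t) *
      (f (a - t) * chirpFactor h τ z (a - t)) =
      (∫ t, conj (g t) * groundFactor h τ z t) * ∫ s, f s * chirpFactor h τ z s :=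
    integral_convolution (ContinuousLinearMap.mul ℂ ℂ) hv hu
  rw [Measure.volume_eq_prod] at hint ⊢
  rw [integral_prod _ hint]
  simp_rw [integral_symbol_kernel_mul_matrixCoeff_slice hh hτ f g z]
  rw [integral_const_mul, hconv, groundTransform_conj, chirpTransform]
  have hphase : Complex.exp (-(Real.pi * Complex.I * h * (inner ℝ z.1 z.2 : ℝ))) *
      Complex.exp (Real.pi * Complex.I * h * (inner ℝ z.1 z.2 : ℝ)) = 1 := by
    rw [← Complex.exp_add, neg_add_cancel, Complex.exp_zero]
  have hconst := symbol_pairing_const (n := n) hh hτ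
  generalize (2 / (h * τ)) ^ ((n : ℝ) / 2) * (1 / (h * τ)) ^ ((n : ℝ) / 2) = k at hconst ⊢
  generalize (h ^ 2 / τ) ^ ((n : ℝ) / 2) * 2 ^ ((n : ℝ) / 2) = k' at hconst ⊢
  generalize (h ^ 2 / τ) ^ ((n : ℝ) / 2) = k'' at hconst ⊢
  have hconst' : ((h ^ (3 * n) : ℝ) : ℂ) * (k : ℂ) = (k'' : ℂ) * k' := by exact_mod_cast hconst
  change _ = _ * _ * (∫ s, f s * chirpFactor h τ z s) * _
  generalize (∫ t, conj (g t) * groundFactor h τ z t) = Iv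
  generalize (∫ s, f s * chirpFactor h τ z s) = Iu
  linear_combination (Iv * Iu) * hconst' - k'' * k' * (Iv * Iu) * hphase

/-- The bound is uniform in `p` and `q`, which is what Fubini against an integrable matrix
coefficient needs. -/
theorem integral_norm_symbol_integrand_le (hh : 0 < h) (hτ : 0 < τ)
    (ψ : Lp ℂ ∞ (volume : Measure (Phase (Fin n)))) (p q : Phase (Fin n)) :
    ∫ z, ‖ψ z * leftAction h ((2 : ℝ) • z - p) (phaseGaussian h τ) q‖ ≤
      ‖ψ‖ * (|((2 : ℝ) ^ Module.finrank ℝ (Phase (Fin n)))⁻¹| * (2 / h) ^ n) := by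
  have hG := memLp_one_iff_integrable.1 (memLp_phaseGaussian_shift_one hh hτ (q + p))
  have hGint : ∫ z : Phase (Fin n), ‖phaseGaussian h τ (q + p - (2 : ℝ) • z)‖ =
      |((2 : ℝ) ^ Module.finrank ℝ (Phase (Fin n)))⁻¹| * (2 / h) ^ n := by
    rw [integral_norm_eq_lintegral_enorm hG.1, lintegral_enorm_phaseGaussian_shift hh hτ,
      ENNReal.toReal_ofReal (by positivity)]
  rw [← hGint, ← integral_const_mul]
  refine integral_mono_ae
    (integrable_symbol_integrand hh hτ (Or.inr (Lp.memLp ψ)) p q).norm (hG.norm.const_mul _) ?_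
  have hbd : ∀ᵐ z, ‖ψ z‖ ≤ ‖ψ‖ := by
    have := ae_le_eLpNormEssSup (f := (ψ : Phase (Fin n) → ℂ)) (μ := volume)
    filter_upwards [this] with z hz
    rw [← eLpNorm_exponent_top, ← Lp.enorm_def] at hz
    exact enorm_le_iff_norm_le.1 hz
  filter_upwards [hbd] with z hz
  rw [norm_mul, norm_leftAction_phaseGaussian, sub_sub_eq_add_sub]
  exact mul_le_mul_of_nonneg_right hz (norm_nonneg _)

theorem integrable_symbol_kernel_mul (hh : 0 < h) (hτ : 0 < τ)
    (ψ : Lp ℂ ∞ (volume : Measure (Phase (Fin n)))) {M : Phase (Fin n ⊕ Fin n) → ℂ}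
    (hM : Integrable M) :
    Integrable (fun w : Phase (Fin n ⊕ Fin n) × Phase (Fin n) =>
      ψ w.2 * leftAction h ((2 : ℝ) • w.2 - firstPair w.1) (phaseGaussian h τ)
        (secondPair τ w.1) * M w.1) (volume.prod volume) := by
  have hmeas : AEStronglyMeasurable (fun w : Phase (Fin n ⊕ Fin n) × Phase (Fin n) =>
      ψ w.2 * leftAction h ((2 : ℝ) • w.2 - firstPair w.1) (phaseGaussian h τ)
        (secondPair τ w.1) * M w.1) (volume.prod volume) :=
    (((Lp.stronglyMeasurable ψ).comp_measurable measurable_snd).mul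
      ((continuous_symbol_kernel h τ).comp continuous_swap).stronglyMeasurable).aestronglyMeasurable.mul
      hM.1.comp_fst
  rw [integrable_prod_iff hmeas]
  constructor
  · refine Filter.Eventually.of_forall fun p => ?_
    have := (integrable_symbol_integrand hh hτ (Or.inr (Lp.memLp ψ)) (firstPair p)
      (secondPair τ p)).mul_const (M p)
    exact this
  · refine (hM.norm.const_mul (‖ψ‖ * (|((2 : ℝ) ^ Module.finrank ℝ (Phase (Fin n)))⁻¹| *
      (2 / h) ^ n))).mono' hmeas.norm.integral_prod_right'
      (Filter.Eventually.of_forall fun p => ?_)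
    have e1 : ∀ z, ‖ψ z * leftAction h ((2 : ℝ) • z - firstPair p) (phaseGaussian h τ)
        (secondPair τ p) * M p‖ = ‖ψ z * leftAction h ((2 : ℝ) • z - firstPair p)
          (phaseGaussian h τ) (secondPair τ p)‖ * ‖M p‖ := fun z => norm_mul _ _
    rw [Real.norm_of_nonneg (integral_nonneg fun _ => norm_nonneg _)]
    simp only [e1]
    rw [integral_mul_const]
    exact mul_le_mul_of_nonneg_right
      (integral_norm_symbol_integrand_le hh hτ ψ (firstPair p) (secondPair τ p)) (norm_nonneg _)

/-- A family of operators with the appropriate weak integral representation consists of Weyl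
pseudodifferential operators with the symbols `toeplitzSymbol`. -/
theorem isWeylPDO_toeplitzSymbol (hh : 0 < h) (hτ : 0 < τ)
    (ψ : Lp ℂ ∞ (volume : Measure (Phase (Fin n))))
    (A : L2 (DoubleConfig n) →L[ℂ] L2 (DoubleConfig n))
    (hA : ∀ f g : 𝓢(DoubleConfig n, ℂ),
      inner ℂ (g.toLp 2 volume : L2 (DoubleConfig n)) (A (f.toLp 2 volume)) =
        ∫ z, ψ z * (chirpTransform h τ f z * conj (groundTransform h τ g z))) :
    IsWeylPDO h (toeplitzSymbol h τ ψ) A := by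
  intro f g
  let f' : 𝓢(DoubleConfig n, ℂ) :=
    SchwartzMap.compCLMOfContinuousLinearEquiv ℂ (ContinuousLinearEquiv.neg ℝ) f
  have hM : Integrable (matrixCoeff h (fun t => f (-t)) g) := integrable_matrixCoeff hh f' g
  have hker := integrable_symbol_kernel_mul hh hτ ψ hM
  have e1 : ∀ p, toeplitzSymbol h τ ψ p * symplFourier h (matrixCoeff h f g) (-p) =
      ((h ^ (3 * n) : ℝ) : ℂ) * ∫ z, ψ z * leftAction h ((2 : ℝ) • z - firstPair p)
        (phaseGaussian h τ) (secondPair τ p) * matrixCoeff h (fun t => f (-t)) g p := by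
    intro p
    rw [symplFourier_matrixCoeff_neg hh, toeplitzSymbol, integral_mul_const, mul_assoc]
  simp_rw [e1]
  refine ⟨hker.integral_prod_left.const_mul _, ?_⟩
  rw [hA, integral_const_mul, integral_integral_swap (f := fun (p : Phase (Fin n ⊕ Fin n)) (z : Phase (Fin n)) =>
      ψ z * leftAction h ((2 : ℝ) • z - firstPair p) (phaseGaussian h τ) (secondPair τ p) *
        matrixCoeff h (fun t => f (-t)) g p) hker, ← integral_const_mul]
  refine integral_congr_ae (Filter.Eventually.of_forall fun z => ?_)
  simp only
  rw [← integral_symbol_kernel_mul_matrixCoeff hh hτ f g hM z]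
  simp only [mul_assoc]
  rw [integral_const_mul]
  ring

theorem coeFn_mulOp (ψ : Lp ℂ ∞ (volume : Measure (Phase (Fin n)))) (F : L2 (Phase (Fin n))) :
    mulOp ψ F =ᵐ[volume] fun z => ψ z * F z :=
  ContinuousLinearMap.coeFn_holder (r := 2) (ContinuousLinearMap.mul ℂ ℂ) ψ F

/-- The Toeplitz operators are unitarily equivalent to Weyl pseudodifferential operators. -/
theorem exists_unitary_isWeylPDO (hh : 0 < h) (hτ : 0 < τ) :
    ∃ U : L2 (Phase (Fin n)) ≃ₗᵢ[ℂ] L2 (DoubleConfig n),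
      ∀ ψ : Lp ℂ ∞ (volume : Measure (Phase (Fin n))),
        IsWeylPDO h (toeplitzSymbol h τ ψ)
          ((U : L2 (Phase (Fin n)) →L[ℂ] L2 (DoubleConfig n)) ∘L
            (fsbSpace (Fin n) h τ).subtypeL ∘L toeplitz h τ ψ ∘L
            (U.symm : L2 (DoubleConfig n) →L[ℂ] L2 (Phase (Fin n)))) := by
  obtain ⟨B, hB⟩ := exists_unitary_eq_chirpTransform (n := n) hh hτ
  obtain ⟨J, hJ⟩ := exists_tensor_isometry (continuous_unitGroundState (n := n) h τ).measurable
    (lintegral_enorm_unitGroundState_sq hh hτ)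
  have hBJ := unitary_tensor_ae_eq hh hτ B hB J hJ
  have hP := orthogonalProjection_unitary_ae_eq hh hτ B J hJ hBJ
  refine ⟨B.symm, fun ψ => isWeylPDO_toeplitzSymbol hh hτ ψ _ fun f g => ?_⟩
  let K := fsbSpace (Fin n) h τ
  -- The projection is self-adjoint and is moved to the side of `g`; `f` then enters through `B`
  -- alone and `g` through `groundTransform`.
  have e1 : inner ℂ (g.toLp 2 volume : L2 (DoubleConfig n))
      (B.symm (K.starProjection (mulOp ψ (B (f.toLp 2 volume))))) =
      inner ℂ (K.starProjection (B (g.toLp 2 volume))) (mulOp ψ (B (f.toLp 2 volume))) := by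
    rw [← B.inner_map_map, B.apply_symm_apply, Submodule.inner_starProjection_left_eq_right]
  have hf := hB f f.integrable (f.memLp 2 volume)
  have hgW : groundTransform h τ (g.toLp 2 volume : L2 (DoubleConfig n)) =
      groundTransform h τ g := by
    funext z
    simp only [groundTransform]
    congr 1
    refine integral_congr_ae ?_
    filter_upwards [g.coeFn_toLp 2 volume] with t ht
    rw [ht]
  change inner ℂ _ (B.symm (K.starProjection (mulOp ψ (B (f.toLp 2 volume))))) = _
  rw [e1, L2.inner_def]
  refine integral_congr_ae ?_
  filter_upwards [hP (g.toLp 2 volume), coeFn_mulOp ψ (B (f.toLp 2 volume)), hf] with z h1 h2 h3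
  have h3' : B (f.toLp 2 volume) z = chirpTransform h τ f z := h3
  rw [RCLike.inner_apply, h1, h2, h3', hgW, mul_assoc]

end WeylPairing

/-! ### The three claims assembled -/

theorem mainTheorem4 (n : ℕ) (hn : 0 < n) (h τ : ℝ) (hh : 0 < h) (hτ : 0 < τ) :
    -- unitary equivalence of the Toeplitz operators and the pseudodifferential operators
    (∃ U : L2 (Phase (Fin n)) ≃ₗᵢ[ℂ] L2 (DoubleConfig n),
      ∀ ψ : Lp ℂ ∞ (volume : Measure (Phase (Fin n))),
        IsWeylPDO h (toeplitzSymbol h τ ψ)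
          ((U : L2 (Phase (Fin n)) →L[ℂ] L2 (DoubleConfig n)) ∘L
            (fsbSpace (Fin n) h τ).subtypeL ∘L toeplitz h τ ψ ∘L
            (U.symm : L2 (DoubleConfig n) →L[ℂ] L2 (Phase (Fin n))))) ∧
    -- the integral for the symbol converges absolutely, and the second form of the symbol
    (∀ (ψ : Lp ℂ ∞ (volume : Measure (Phase (Fin n)))) (p : Phase (Fin n ⊕ Fin n)),
      Integrable (fun z => ψ z *
        leftAction h ((2 : ℝ) • z - firstPair p) (phaseGaussian h τ) (secondPair τ p)) ∧
      toeplitzSymbol h τ ψ p = ((h ^ (3 * n) : ℝ) : ℂ) *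
        ∫ z, ψ z * conj (leftAction h (secondPair τ p) (phaseGaussian h τ)
          ((2 : ℝ) • z - firstPair p))) ∧
    -- a bounded function is determined by its symbol
    (∀ ψ₁ ψ₂ : Lp ℂ ∞ (volume : Measure (Phase (Fin n))),
      toeplitzSymbol h τ ψ₁ =ᵐ[volume] toeplitzSymbol h τ ψ₂ → ψ₁ = ψ₂) ∧
    -- on `L²` the symbol map is a multiple of an isometry, and has a bounded left inverse
    (∃ R : L2 (Phase (Fin n ⊕ Fin n)) →L[ℂ] L2 (Phase (Fin n)),
      ∀ ψ : L2 (Phase (Fin n)), ∃ a : L2 (Phase (Fin n ⊕ Fin n)),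
        a =ᵐ[volume] toeplitzSymbol h τ ψ ∧ ‖a‖ ^ 2 = h ^ (3 * n) * ‖ψ‖ ^ 2 ∧ R a = ψ) ∧
    -- the heat-flow smoothing has no bounded left inverse on `L²`
    ((∀ ψ : L2 (Phase (Fin n)), MemLp (guilleminSymbol h τ ψ) 2 volume) ∧
      ¬ ∃ R : L2 (Phase (Fin n)) →L[ℂ] L2 (Phase (Fin n)),
        ∀ ψ a : L2 (Phase (Fin n)), a =ᵐ[volume] guilleminSymbol h τ ψ → R a = ψ) := by
  refine ⟨exists_unitary_isWeylPDO hh hτ, fun ψ p => ⟨?_, ?_⟩, toeplitzSymbol_injective hh hτ,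
    ?_, fun ψ => ?_, not_exists_leftInverse_guilleminSymbol hn hh hτ⟩
  · exact integrable_symbol_integrand hh hτ (Or.inr (Lp.memLp ψ)) _ _
  · simp only [toeplitzSymbol]
    congr 1
    refine integral_congr_ae (Filter.Eventually.of_forall fun z => ?_)
    simp only
    rw [← leftAction_phaseGaussian_conj]
  · obtain ⟨R, hR⟩ := exists_leftInverse_of_norm_sq (symbolMap (n := n) hh hτ)
      (k := h ^ (3 * n)) (by positivity) (norm_symbolMap_sq hh hτ)
    exact ⟨R, fun ψ => ⟨symbolMap hh hτ ψ, coeFn_symbolMap hh hτ ψ, norm_symbolMap_sq hh hτ ψ,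
      hR ψ⟩⟩
  · exact memLp_guilleminSymbol hh hτ (Lp.stronglyMeasurable ψ) (Lp.memLp ψ)
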